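/- **Lieberman's theorem via normal semi-cosimplicial Hilbert spaces.** Let $\mathbb S_\infty$ be the group of finite permutations of $\mathbb N_0$, with Coxeter generators $\sigma_k=(k-1\;\,k)$, $k\ge 1$, and with the topology of pointwise convergence on $\mathbb N_0$. Let $\pi$ be a *tame* unitary representation of $\mathbb S_\infty$ on a complex Hilbert space $\mathcal H$, i.e. $\pi$ is continuous for the strong operator topology. Subspaces below are closed. An (augmented) semi-cosimplicial Hilbert space (SCH) on $\mathcal H$ is a tower $\mathcal H_{-1}\subset\mathcal H_0\subset\mathcal H_1\subset\cdots$ of closed subspaces with dense union, with isometries $\alpha_i$ ($i\ge 0$) of $\mathcal H$ such that $\alpha_j\alpha_i=\alpha_i\alpha_{j-1}$ for $i<j$, $\alpha_i\mathcal H_{n-1}\subset\mathcal H_n$, and $\alpha_n$ is the identity on $\mathcal H_{n-1}$; put $\delta_i=\alpha_i|_{\mathcal H_{n-1}}:\mathcal H_{n-1}\to\mathcal H_n$ for $0\le i\le n$. It is *normal* if $\delta_{j-1}\delta_i^*=\delta_i^*\delta_j$ on $\mathcal H_k$ for all $k\ge 0$ and $0\le i<j\le k+1$. A *label* is a finite set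 $A\subset\mathbb N_0$; its rank is $|A|$ and its level is $\max A$ (and $-1$ for $A=\emptyset$). The *root space* of rank $m+1$ ($m\ge -1$) is $$L_{[m]}=\{x\in\mathcal H_m:\ x\perp\alpha_i(\mathcal H_{m-1})\text{ for all } i\ge 0\}\qquad(L_{[-1]}=\mathcal H_{-1}).$$ For a label $A$ of rank $m+1$ and level $n$, let $i_1<\dots<i_k$ be the elements of $\{0,\dots,n\}\setminus A$, and put $\alpha_A=\alpha_{i_k}\cdots\alpha_{i_1}$ and $L_A=\alpha_A L_{[m]}$ (the *labeled subspace* of $A$). Let $\mathcal H^{(m+1)}$ be the closed span of the $L_A$ with $|A|=m+1$. Then the following hold. 1. The subspaces $\mathcal H_n=\{x:\pi(\sigma_k)x=x\text{ for all }k\ge n+2\}$ and the strong limits $\alpha_i=\lim_{N\to\infty}\pi(\sigma_{i+1}\sigma_{i+2}\cdots\sigma_{N})$ (which exist) form an SCH on $\mathcal H$, and it is normal. The notation below refers to this SCH. 2. The labeled subspaces are mutually orthogonal, $\mathcal H=\bigoplus_A L_A$ (Hilbert sum), and $\pi(g)L_A=L_{g(A)}$ for all $g\in\mathbb S_\infty$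 and all labels $A$. 3. Each $\mathcal H^{(m+1)}$ is $\mathbb S_\infty$-invariant, and every $\mathbb S_\infty$-invariant subspace $\mathcal K$ is the closed span of the subspaces $\mathcal K\cap\mathcal H^{(m+1)}$, $m\ge -1$. 4. For each $m\ge -1$ we have $\mathcal H_m\cap\mathcal H^{(m+1)}=L_{[m]}$, and $\mathcal K\mapsto\mathcal K\cap L_{[m]}$ is a bijection from the $\mathbb S_\infty$-invariant subspaces of $\mathcal H^{(m+1)}$ onto the $S_{m+1}$-invariant subspaces of $L_{[m]}$, where $S_{m+1}$ is the group of permutations of $\{0,\dots,m\}$. The inverse maps $\mathcal W$ to the closed span of the $\alpha_A\mathcal W$, $|A|=m+1$. 5. If $\mathcal K\subset\mathcal H^{(m+1)}$ is an $\mathbb S_\infty$-invariant subspace, then $\mathcal K\cap L_{[m]}$ is $S_{m+1}$-invariant and the subrepresentation on $\mathcal K$ is unitarily equivalent to the representation of $\mathbb S_\infty$ induced from the open subgroup $S_{m+1}\times S_{>m}$ (the finite permutations preserving $\{0,\dots,m\}$), acting on $\mathcal K\cap L_{[m]}$ through the restriction of $\pi$ to $S_{m+1}$, with the tail $S_{>m}$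 acting trivially. 6. $\mathcal H$ is the Hilbert sum of a family of $\mathbb S_\infty$-invariant subspaces on which $\pi$ is irreducible. 7. If $\mathcal V$ is an $\mathbb S_\infty$-invariant subspace on which $\pi$ is irreducible (for example $\mathcal V=\mathcal H$ if $\pi$ is irreducible), then there is $m\ge -1$ such that $\mathcal V\subset\mathcal H^{(m+1)}$, the root space $\mathcal V\cap L_{[m]}$ is finite-dimensional and carries, by restriction of $\pi$, an irreducible representation of $S_{m+1}$, and the subrepresentation on $\mathcal V$ is unitarily equivalent to the representation induced from this irreducible representation of $S_{m+1}$, extended to $S_{m+1}\times S_{>m}$ with the tail acting trivially. -/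

import Mathlib

open Filter Topology

/-! ### The infinite symmetric group -/

/-- `S_∞`, the group of all permutations of `ℕ` that move only finitely many points. -/
def SInf : Subgroup (Equiv.Perm ℕ) where
  carrier := {g | {i | g i ≠ i}.Finite}
  one_mem' := by simp
  mul_mem' := by
    intro a b ha hb
    refine (ha.union hb).subset ?_
    intro i hi
    by_contra h
    simp only [Set.mem_union, Set.mem_ofPred_eq, not_or, not_not] at h
    exact hi (by rw [Equiv.Perm.mul_apply, h.2, h.1])
  inv_mem' := by
    intro a ha
    refine Set.Finite.subset ha ?_
    intro i hi h
    exact hi (by rw [Equiv.Perm.inv_eq_iff_eq]; exact h.symm)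

/-- The Coxeter generator of `S_∞` that exchanges the positions `k` and `k + 1`
(usually written `σ_{k+1}`). -/
def coxeter (k : ℕ) : SInf :=
  ⟨Equiv.swap k (k + 1), by
    refine Set.Finite.subset (Set.toFinite {k, k + 1}) ?_
    intro i hi
    by_contra h
    simp only [Set.mem_insert_iff, Set.mem_singleton_iff, not_or] at h
    exact hi (Equiv.swap_apply_of_ne_of_ne h.1 h.2)⟩

/-- The topology of pointwise convergence on `S_∞` for its action on the discrete set `ℕ`. -/
@[reducible] def SInf.pointwiseTopology : TopologicalSpace SInf :=
  TopologicalSpace.induced (fun (g : SInf) (i : ℕ) => (g : Equiv.Perm ℕ) i) inferInstance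

/-- The finite symmetric group `S_r` on the points `0, …, r - 1`, as a subgroup of `S_∞`. -/
def symIncl (r : ℕ) : Equiv.Perm (Fin r) →* SInf :=
  (Equiv.Perm.extendDomainHom (Fin.equivSubtype (n := r))).codRestrict SInf (by
    intro s
    refine Set.Finite.subset (Set.finite_lt_nat r) ?_
    intro i hi
    by_contra h
    exact hi (Equiv.Perm.extendDomain_apply_not_subtype s Fin.equivSubtype h))

/-- The subgroup `S_r × S_{≥ r}` of `S_∞`: the finite permutations that map
`{0, …, r - 1}` to itself. -/
def young (r : ℕ) : Subgroup SInf where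
  carrier := {g | ∀ i : ℕ, (g : Equiv.Perm ℕ) i < r ↔ i < r}
  one_mem' := by intro i; simp
  mul_mem' := by
    intro a b ha hb i
    exact (ha _).trans (hb i)
  inv_mem' := by
    intro a ha i
    have h := ha ((a : Equiv.Perm ℕ).symm i)
    rw [Equiv.apply_symm_apply] at h
    exact h.symm

/-- The projection `S_r × S_{≥ r} → S_r`, which forgets the tail. -/
def youngProj (r : ℕ) : young r →* Equiv.Perm (Fin r) where
  toFun g :=
    { toFun := fun i => ⟨(g : Equiv.Perm ℕ) i, (g.2 i).2 i.2⟩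
      invFun := fun i => ⟨((g⁻¹ : young r) : Equiv.Perm ℕ) i, ((g⁻¹ : young r).2 i).2 i.2⟩
      left_inv := fun i => by ext; simp
      right_inv := fun i => by ext; simp }
  map_one' := by ext; simp
  map_mul' := by intro a b; ext; simp

/-! ### Unitary representations

A unitary representation of `G` on `V` is a group homomorphism `G →* (V ≃ₗᵢ[ℂ] V)` into the
group of surjective linear isometries of `V`. -/

section Representations

variable {G H V V' : Type*} [Group G]
  [NormedAddCommGroup H] [InnerProductSpace ℂ H]
  [NormedAddCommGroup V] [InnerProductSpace ℂ V]
  [NormedAddCommGroup V'] [InnerProductSpace ℂ V']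

/-- A unitary representation of `S_∞` is tame if it is continuous for the topology of pointwise
convergence on `S_∞` and the strong operator topology. -/
def IsTame (π : SInf →* (H ≃ₗᵢ[ℂ] H)) : Prop :=
  ∀ x : H, @Continuous SInf H SInf.pointwiseTopology _ (fun g => π g x)

def IsInvariantSubspace (π : G →* (V ≃ₗᵢ[ℂ] V)) (K : Submodule ℂ V) : Prop :=
  ∀ g : G, ∀ x ∈ K, π g x ∈ K

/-- The subrepresentation on an invariant subspace. -/
def subrep (π : G →* (V ≃ₗᵢ[ℂ] V)) (K : Submodule ℂ V) (hK : IsInvariantSubspace π K) :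
    G →* (K ≃ₗᵢ[ℂ] K) where
  toFun g :=
    { toFun := fun x => ⟨π g x, hK g x x.2⟩
      map_add' := fun x y => by ext; simp
      map_smul' := fun c x => by ext; simp
      invFun := fun x => ⟨π g⁻¹ x, hK g⁻¹ x x.2⟩
      left_inv := fun x => by ext; simp [map_inv, LinearIsometryEquiv.inv_def]
      right_inv := fun x => by ext; simp [map_inv, LinearIsometryEquiv.inv_def]
      norm_map' := fun x => (π g).norm_map x }
  map_one' := by ext; simp
  map_mul' a b := by ext; simp

/-- Irreducibility: the space is nonzero and has no closed invariant subspaces except the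
trivial ones. -/
def IsIrreducibleRep (π : G →* (V ≃ₗᵢ[ℂ] V)) : Prop :=
  Nontrivial V ∧ ∀ K : Submodule ℂ V, IsClosed (K : Set V) → IsInvariantSubspace π K → K = ⊥ ∨ K = ⊤

def UnitarilyEquivalent (π : G →* (V ≃ₗᵢ[ℂ] V)) (π' : G →* (V' ≃ₗᵢ[ℂ] V')) : Prop :=
  ∃ U : V ≃ₗᵢ[ℂ] V', ∀ g x, U (π g x) = π' g (U x)

end Representations

/-! ### Induced representations -/

theorem memlp_iff_summable_sq {ι W : Type*} [NormedAddCommGroup W] (f : ι → W) :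
    Memℓp f 2 ↔ Summable fun i => ‖f i‖ ^ 2 := by
  rw [memℓp_gen_iff (by norm_num)]
  simp

section Induction

variable {G W : Type*} [Group G] [NormedAddCommGroup W] [InnerProductSpace ℂ W]
  {K : Subgroup G} (ρ : K →* (W ≃ₗᵢ[ℂ] W))

/-- The functions `f : G → W` with `f (g h) = ρ(h)⁻¹ f(g)` for `h ∈ K`. -/
def IsCovariant (f : G → W) : Prop := ∀ (g : G) (h : K), f (g * h) = (ρ h)⁻¹ (f g)

variable {ρ} in
theorem IsCovariant.inner_mul {f f' : G → W} (hf : IsCovariant ρ f) (hf' : IsCovariant ρ f')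
    (g : G) (h : K) : inner ℂ (f (g * h)) (f' (g * h)) = inner ℂ (f g) (f' g) := by
  rw [hf, hf', LinearIsometryEquiv.inner_map_map]

variable {ρ} in
theorem IsCovariant.inner_eq {f f' : G → W} (hf : IsCovariant ρ f) (hf' : IsCovariant ρ f')
    {a b : G} (hab : (a : G ⧸ K) = b) : inner ℂ (f a) (f' a) = inner ℂ (f b) (f' b) := by
  have := hf.inner_mul hf' a ⟨a⁻¹ * b, QuotientGroup.eq.1 hab⟩
  simpa using this.symm

variable {ρ} in
theorem IsCovariant.norm_sq_eq {f : G → W} (hf : IsCovariant ρ f)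
    {a b : G} (hab : (a : G ⧸ K) = b) : ‖f a‖ ^ 2 = ‖f b‖ ^ 2 := by
  have := hf.inner_eq hf hab
  rw [inner_self_eq_norm_sq_to_K, inner_self_eq_norm_sq_to_K] at this
  exact_mod_cast this

/-- The space of the induced representation `Ind_K^G ρ`: covariant functions on `G` that are
square summable over `G ⧸ K` (their norm is constant on each coset). -/
def inducedSubmodule : Submodule ℂ (G → W) where
  carrier := {f | IsCovariant ρ f ∧ Summable fun q : G ⧸ K => ‖f q.out‖ ^ 2}
  zero_mem' := ⟨fun g h => by simp, by simp⟩
  add_mem' := by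
    rintro f f' ⟨hf, hs⟩ ⟨hf', hs'⟩
    refine ⟨fun g h => by simp [hf g h, hf' g h], ?_⟩
    have := ((memlp_iff_summable_sq (fun q : G ⧸ K => f q.out)).2 hs).add
      ((memlp_iff_summable_sq (fun q : G ⧸ K => f' q.out)).2 hs')
    exact (memlp_iff_summable_sq _).1 this
  smul_mem' := by
    rintro c f ⟨hf, hs⟩
    refine ⟨fun g h => by simp [hf g h], ?_⟩
    simpa [norm_smul, mul_pow] using hs.mul_left (‖c‖ ^ 2)

def InducedSpace : Type _ := ↥(inducedSubmodule ρ)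

namespace InducedSpace

noncomputable instance : AddCommGroup (InducedSpace ρ) :=
  inferInstanceAs (AddCommGroup ↥(inducedSubmodule ρ))

noncomputable instance : Module ℂ (InducedSpace ρ) :=
  inferInstanceAs (Module ℂ ↥(inducedSubmodule ρ))

variable {ρ}

/-- The elements of the induced space as functions on `G`. -/
def eval (f : InducedSpace ρ) : G → W := Subtype.val (p := (· ∈ inducedSubmodule ρ)) f

instance : CoeFun (InducedSpace ρ) (fun _ => G → W) := ⟨eval⟩

theorem covariant (f : InducedSpace ρ) : IsCovariant ρ f := (Subtype.property f).1

theorem summable (f : InducedSpace ρ) : Summable fun q : G ⧸ K => ‖f q.out‖ ^ 2 :=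
  (Subtype.property f).2

theorem ext {f f' : InducedSpace ρ} (h : ∀ g, f g = f' g) : f = f' := Subtype.ext (funext h)

variable (ρ)

/-- Restriction of a covariant function to a set of representatives. -/
noncomputable def toLp : InducedSpace ρ →ₗ[ℂ] lp (fun _ : G ⧸ K => W) 2 where
  toFun f := ⟨fun q => f q.out, (memlp_iff_summable_sq _).2 f.summable⟩
  map_add' _ _ := rfl
  map_smul' _ _ := rfl

theorem toLp_injective : Function.Injective (toLp ρ) := by
  intro f f' h
  refine ext fun g => ?_
  have hq : f (g : G ⧸ K).out = f' (g : G ⧸ K).out :=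
    congrArg (fun v : lp (fun _ : G ⧸ K => W) 2 => v (g : G ⧸ K)) h
  obtain ⟨k, hk⟩ := QuotientGroup.mk_out_eq_mul K g
  rw [hk, f.covariant, f'.covariant] at hq
  exact (ρ k)⁻¹.injective hq

/-- The inner product `⟪f, f'⟫ = ∑_{q ∈ G ⧸ K} ⟪f q, f' q⟫`. -/
noncomputable instance : Inner ℂ (InducedSpace ρ) :=
  ⟨fun f f' => ∑' q : G ⧸ K, inner ℂ (f q.out) (f' q.out)⟩

theorem inner_def (f f' : InducedSpace ρ) :
    inner ℂ f f' = ∑' q : G ⧸ K, inner ℂ (f q.out) (f' q.out) := rfl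

theorem inner_toLp (f f' : InducedSpace ρ) :
    inner ℂ f f' = inner ℂ (toLp ρ f) (toLp ρ f') := by
  rw [lp.inner_eq_tsum]
  rfl

@[reducible] noncomputable def core : InnerProductSpace.Core ℂ (InducedSpace ρ) where
  inner := inner ℂ
  conj_inner_symm f f' := by simp only [inner_toLp]; exact inner_conj_symm _ _
  re_inner_nonneg f := by simp only [inner_toLp]; exact inner_self_nonneg
  add_left f f' f'' := by simp only [inner_toLp, map_add]; exact inner_add_left _ _ _
  smul_left f f' c := by simp only [inner_toLp, map_smul]; exact inner_smul_left _ _ _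
  definite f hf := by
    simp only [inner_toLp] at hf
    exact toLp_injective ρ ((inner_self_eq_zero.1 hf).trans (map_zero _).symm)

noncomputable instance : NormedAddCommGroup (InducedSpace ρ) :=
  (core ρ).toNormedAddCommGroup

noncomputable instance : InnerProductSpace ℂ (InducedSpace ρ) :=
  InnerProductSpace.ofCore (core ρ).toCore

theorem out_smul_eq (a : G) (q : G ⧸ K) : ((a * q.out : G) : G ⧸ K) = ((a • q).out : G) := by
  rw [QuotientGroup.out_eq']
  conv_rhs => rw [← QuotientGroup.out_eq' q]
  rfl

/-- Left translation: the function `g ↦ f (a⁻¹ g)`. -/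
def translate (a : G) (f : InducedSpace ρ) : InducedSpace ρ :=
  ⟨fun g => f (a⁻¹ * g), fun g h => by simpa only [mul_assoc] using f.covariant (a⁻¹ * g) h, by
    have h : (fun q : G ⧸ K => ‖f (a⁻¹ * q.out)‖ ^ 2) =
        (fun q : G ⧸ K => ‖f q.out‖ ^ 2) ∘ (MulAction.toPerm a⁻¹ : Equiv.Perm (G ⧸ K)) := by
      funext q
      exact f.covariant.norm_sq_eq (out_smul_eq a⁻¹ q)
    rw [h]
    exact (Equiv.summable_iff _).2 f.summable⟩

theorem translate_apply (a : G) (f : InducedSpace ρ) (g : G) :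
    translate ρ a f g = f (a⁻¹ * g) := rfl

theorem inner_translate (a : G) (f f' : InducedSpace ρ) :
    inner ℂ (translate ρ a f) (translate ρ a f') = inner ℂ f f' := by
  rw [inner_def, inner_def,
    ← Equiv.tsum_eq (MulAction.toPerm a⁻¹ : Equiv.Perm (G ⧸ K))
      (fun q => inner ℂ (f q.out) (f' q.out))]
  exact tsum_congr fun q => f.covariant.inner_eq f'.covariant (out_smul_eq a⁻¹ q)

theorem translate_mul (a b : G) (f : InducedSpace ρ) :
    translate ρ (a * b) f = translate ρ a (translate ρ b f) :=
  ext fun g => by simp only [translate_apply, mul_inv_rev, mul_assoc]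

theorem translate_one (f : InducedSpace ρ) : translate ρ 1 f = f :=
  ext fun g => by simp only [translate_apply, inv_one, one_mul]

end InducedSpace

/-- The unitary representation of `G` induced from the unitary representation `ρ` of the
subgroup `K`; `G` is treated as a discrete set, which is the usual construction when `K` is an
open subgroup. -/
noncomputable def inducedRep : G →* (InducedSpace ρ ≃ₗᵢ[ℂ] InducedSpace ρ) where
  toFun a :=
    { toFun := InducedSpace.translate ρ a
      map_add' := fun _ _ => rfl
      map_smul' := fun _ _ => rfl
      invFun := InducedSpace.translate ρ a⁻¹
      left_inv := fun f => by
        rw [← InducedSpace.translate_mul, inv_mul_cancel, InducedSpace.translate_one]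
      right_inv := fun f => by
        rw [← InducedSpace.translate_mul, mul_inv_cancel, InducedSpace.translate_one]
      norm_map' := fun f => by
        rw [@norm_eq_sqrt_re_inner ℂ, @norm_eq_sqrt_re_inner ℂ]
        exact congrArg (fun z : ℂ => Real.sqrt (RCLike.re z))
          (InducedSpace.inner_translate ρ a f f) }
  map_one' := by
    apply LinearIsometryEquiv.ext
    intro f
    exact InducedSpace.translate_one ρ f
  map_mul' a b := by
    apply LinearIsometryEquiv.ext
    intro f
    exact InducedSpace.translate_mul ρ a b f

end Induction

/-- The representation of `S_∞` induced from the representation `τ ⊗ 1` of `S_r × S_{≥ r}`, where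
`τ` is a representation of `S_r` and the tail `S_{≥ r}` acts trivially. -/
noncomputable def inducedFromFinite {W : Type*} [NormedAddCommGroup W] [InnerProductSpace ℂ W]
    (r : ℕ) (τ : Equiv.Perm (Fin r) →* (W ≃ₗᵢ[ℂ] W)) :
    SInf →* (InducedSpace (τ.comp (youngProj r)) ≃ₗᵢ[ℂ] InducedSpace (τ.comp (youngProj r))) :=
  inducedRep (τ.comp (youngProj r))

/-! ### Semi-cosimplicial Hilbert spaces -/

/-- An (augmented) semi-cosimplicial Hilbert space, given as a tower
`H_{-1} ⊆ H_0 ⊆ H_1 ⊆ ⋯` of closed subspaces with dense union in `H = H_∞`, with an adapted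
sequence of partial shifts `α_i` of `H` such that `H_{n-1}` is fixed by `α_n`. Indices of the tower
are moved by one: `tower n` is `H_{n-1}`. The coface operator `δ_i : H_{n-1} → H_n`
(`0 ≤ i ≤ n`) is the restriction of `α_i`. -/
structure SCH (H : Type*) [NormedAddCommGroup H] [InnerProductSpace ℂ H] where
  tower : ℕ → Submodule ℂ H
  shift : ℕ → (H →ₗᵢ[ℂ] H)
  isClosed_tower : ∀ n, IsClosed (tower n : Set H)
  tower_mono : Monotone tower
  dense : (⨆ n, tower n).topologicalClosure = ⊤
  adapted : ∀ i n, ∀ x ∈ tower n, shift i x ∈ tower (n + 1)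
  fixed : ∀ n, ∀ x ∈ tower n, shift n x = x
  cosimplicial : ∀ i j, i < j → ∀ x, shift j (shift i x) = shift i (shift (j - 1) x)

namespace SCH

variable {H : Type*} [NormedAddCommGroup H] [InnerProductSpace ℂ H] (S : SCH H)

/-- The coface operator `δ_i : H_{n-1} → H_n` (only `i ≤ n` is meant). -/
noncomputable def coface (i n : ℕ) : S.tower n →L[ℂ] S.tower (n + 1) :=
  (((S.shift i).toContinuousLinearMap.comp (S.tower n).subtypeL)).codRestrict (S.tower (n + 1))
    (fun x => S.adapted i n x x.2)

instance [CompleteSpace H] (n : ℕ) : CompleteSpace (S.tower n) :=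
  (S.isClosed_tower n).completeSpace_coe

/-- Normality: `δ_{j-1} δ_i^* = δ_i^* δ_j` on `H_k` (here `k = n`, i.e. on `tower (n + 1)`),
whenever `0 ≤ i < j` and the coface operators involved are defined. -/
def IsNormal [CompleteSpace H] : Prop :=
  ∀ n i j : ℕ, i < j → j ≤ n + 1 →
    (S.coface (j - 1) n).comp (ContinuousLinearMap.adjoint (S.coface i n)) =
      (ContinuousLinearMap.adjoint (S.coface i (n + 1))).comp (S.coface j (n + 1))

/-- The root space of rank `r`, i.e. of level `k = r - 1`: the vectors of `H_k` orthogonal to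
`α_i(H_{k-1})` for all `i` (no condition for `k = -1`). -/
noncomputable def rootSpace : ℕ → Submodule ℂ H
  | 0 => S.tower 0
  | r + 1 => S.tower (r + 1) ⊓ ⨅ i : ℕ, ((S.tower r).map (S.shift i).toLinearMap)ᗮ

/-- The isometry `α_A = α_{i_k} ⋯ α_{i_1}` of a label `A ⊆ ℕ` of level `n = max A`, where
`i_1 < ⋯ < i_k` are the elements of `{0, …, n}` outside `A`. -/
noncomputable def labelShift (A : Finset ℕ) : H →ₗᵢ[ℂ] H :=
  ((Finset.range (A.sup (· + 1)) \ A).sort (· ≤ ·)).foldl (fun T i => (S.shift i).comp T)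
    LinearIsometry.id

/-- The labeled subspace `L_A = α_A(L_root)`, where the root of `A` has the same rank as `A`. -/
noncomputable def labeled (A : Finset ℕ) : Submodule ℂ H :=
  (S.rootSpace A.card).map (S.labelShift A).toLinearMap

/-- The closed linear span of the `α_A(W)` over all labels `A` of rank `r`, for a subspace `W` of
the root space of rank `r`. -/
noncomputable def extend (r : ℕ) (W : Submodule ℂ H) : Submodule ℂ H :=
  (⨆ A : {A : Finset ℕ // A.card = r}, W.map (S.labelShift A).toLinearMap).topologicalClosure

/-- The subspace of the vectors of rank `r`: the closed span of the labeled subspaces of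
rank `r`. -/
noncomputable def rankSpace (r : ℕ) : Submodule ℂ H := S.extend r (S.rootSpace r)

/-- `S` is the canonical SCH of `π`: the space `H_{n-1}` consists of the vectors fixed by all
Coxeter generators exchanging `k` and `k + 1` with `k ≥ n`, and `α_i` is the strong operator limit
of the products of consecutive generators starting with the one that exchanges `i` and `i + 1`. -/
def IsCanonical (π : SInf →* (H ≃ₗᵢ[ℂ] H)) : Prop :=
  (∀ n x, x ∈ S.tower n ↔ ∀ k, n ≤ k → π (coxeter k) x = x) ∧
  (∀ i x, Tendsto (fun m : ℕ => π (((List.range' i m).map coxeter).prod) x) atTop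
    (𝓝 (S.shift i x)))

end SCH

/-! For a finite set `A`, let F(A) be the space of vectors fixed by all finite permutations that fix
`A` pointwise (`fixedSpace`). On F(A) a permutation acts only through its restriction to `A`, and it
carries F(A) to F(g(A)). The tower consists of the F({0, …, n-1}). It is dense by tameness: an orbit
under the stabilizer of a large initial segment stays near a given vector, and the vector of least
norm in its closed convex hull is fixed by that stabilizer (`exists_mem_fixedSpace_norm_sub_le`).

The main point is that the projections onto F(A) and F(B) multiply to the projection onto F(A ∩ B)
(`inner_eq_zero_of_inter`). Keep `A` fixed and push B \ A to infinity: the translates of a vector of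
F(B) have a weak limit point, which lies in F(A ∩ B), while their inner products with vectors of
F(A) do not change. Hence, if P(A) is the part of F(A) orthogonal to F(B) for all proper subsets B
of `A` (`pureSpace`), the P(A) are mutually orthogonal, span a dense subspace and are permuted by π
like the finite sets.

On vectors of finite level each α_i is implemented by permutations that agree with the increasing
injection omitting `i`. So the image of a coface is F of an initial segment with one point removed,
normality is an instance of the commuting square, and the labeled subspace of `A` is P(A)
(`labeled_eq`).

The projection onto a closed invariant subspace commutes with π, hence preserves every P(A), so
invariant subspaces split along the P(A) and thus by rank. In rank r the group permutes the r-sets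
transitively, the stabilizer of {0, …, r-1} is `young r`, and its tail acts trivially on P({0, …,
r-1}). This system of imprimitivity gives the correspondence with root spaces and the induced
representations. Since S_r is finite, every nonzero invariant subspace of a root space contains a
finite-dimensional irreducible one; Zorn's lemma does the rest. -/

/-! ### Finite permutations -/

namespace SInf

/-- Transpositions, as elements of `S_∞`. -/
def swap (a b : ℕ) : SInf :=
  ⟨Equiv.swap a b, by
    refine Set.Finite.subset (Set.toFinite {a, b}) ?_
    intro i hi
    by_contra h
    simp only [Set.mem_insert_iff, Set.mem_singleton_iff, not_or] at h
    exact hi (Equiv.swap_apply_of_ne_of_ne h.1 h.2)⟩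

@[simp] theorem coe_swap (a b : ℕ) : (swap a b : Equiv.Perm ℕ) = Equiv.swap a b := rfl

@[simp] theorem coe_coxeter (k : ℕ) : (coxeter k : Equiv.Perm ℕ) = Equiv.swap k (k + 1) := rfl

theorem coe_mul_apply (g h : SInf) (i : ℕ) :
    ((g * h : SInf) : Equiv.Perm ℕ) i = (g : Equiv.Perm ℕ) ((h : Equiv.Perm ℕ) i) := rfl

theorem coe_inv_apply_eq_iff (g : SInf) (i j : ℕ) :
    ((g⁻¹ : SInf) : Equiv.Perm ℕ) i = j ↔ i = (g : Equiv.Perm ℕ) j :=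
  Equiv.Perm.inv_eq_iff_eq

/-- A transposition corrects the value at each new point without disturbing the earlier values. This
is how injections of ℕ such as `skip i` are replaced by group elements at finite level. -/
theorem exists_eqOn (A : Finset ℕ) (f : ℕ → ℕ) (hf : Set.InjOn f A) :
    ∃ g : SInf, ∀ i ∈ A, (g : Equiv.Perm ℕ) i = f i := by
  induction A using Finset.induction_on with
  | empty => exact ⟨1, by simp⟩
  | insert a A ha ih =>
    obtain ⟨g, hg⟩ := ih (hf.mono (by simp))
    refine ⟨swap ((g : Equiv.Perm ℕ) a) (f a) * g, fun i hi => ?_⟩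
    rw [coe_mul_apply, coe_swap]
    rcases Finset.mem_insert.1 hi with rfl | hi'
    · simp
    · have hia : i ≠ a := fun h => ha (h ▸ hi')
      rw [Equiv.swap_apply_of_ne_of_ne, hg i hi']
      · exact fun h => hia ((g : Equiv.Perm ℕ).injective h)
      · rw [hg i hi']
        exact fun h => hia (hf (by simp [hi']) (by simp) h)

theorem exists_bound (g : SInf) : ∃ N, ∀ i, N ≤ i → (g : Equiv.Perm ℕ) i = i := by
  obtain ⟨N, hN⟩ := g.2.bddAbove
  refine ⟨N + 1, fun i hi => ?_⟩
  by_contra h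
  have := hN (show i ∈ {i | (g : Equiv.Perm ℕ) i ≠ i} from h)
  omega

/-- The finite permutations that fix the points `0, …, n - 1` are generated by the Coxeter
generators of index at least `n`. -/
theorem mem_of_coxeter_mem {P : Subgroup SInf} {n : ℕ} (hP : ∀ k, n ≤ k → coxeter k ∈ P)
    (g : SInf) (hg : ∀ i < n, (g : Equiv.Perm ℕ) i = i) : g ∈ P := by
  have hswap : ∀ a b, n ≤ a → a < b → swap a b ∈ P := by
    intro a b ha hab
    induction b, hab using Nat.le_induction with
    | base => exact hP a ha
    | succ b hb ih =>
      have : swap a (b + 1) = coxeter b * swap a b * coxeter b := by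
        apply Subtype.ext
        have h := Equiv.swap_mul_swap_mul_swap (x := a) (y := b) (z := b + 1)
          (by omega) (by omega)
        simp only [Subgroup.coe_mul, coe_swap, coe_coxeter]
        rw [h, Equiv.swap_comm]
      rw [this]
      exact P.mul_mem (P.mul_mem (hP b (by omega)) ih) (hP b (by omega))
  obtain ⟨N, hN⟩ := exists_bound g
  induction N generalizing g with
  | zero =>
    have : g = 1 := Subtype.ext (Equiv.ext fun i => hN i (Nat.zero_le i))
    exact this ▸ P.one_mem
  | succ N ih =>
    by_cases hNn : N < n
    · exact ih g hg fun i hi => (eq_or_lt_of_le hi).elim (fun h => h ▸ hg N hNn) (hN i)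
    · by_cases hgN : (g : Equiv.Perm ℕ) N = N
      · exact ih g hg fun i hi => (eq_or_lt_of_le hi).elim (fun h => h ▸ hgN) (hN i)
      · have h1 : (g : Equiv.Perm ℕ) N < N := by
          by_contra h
          have h2 := hN _ (Nat.succ_le_of_lt (lt_of_le_of_ne (not_lt.1 h) (Ne.symm hgN)))
          exact hgN ((g : Equiv.Perm ℕ).injective h2)
        have h3 : n ≤ (g : Equiv.Perm ℕ) N := by
          by_contra h
          have h2 := hg _ (not_le.1 h)
          exact hgN ((g : Equiv.Perm ℕ).injective h2)
        -- Here `n ≤ g N < N`, and the transposition makes `N` a fixed point, which lowers the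
        -- bound.
        have hmem := ih (swap ((g : Equiv.Perm ℕ) N) N * g) (fun i hi => by
            rw [coe_mul_apply, hg i hi, coe_swap, Equiv.swap_apply_of_ne_of_ne] <;> omega)
          (fun i hi => by
            rw [coe_mul_apply, coe_swap]
            rcases eq_or_lt_of_le hi with rfl | hi
            · simp
            · rw [hN i hi, Equiv.swap_apply_of_ne_of_ne] <;> omega)
        exact (Subgroup.mul_mem_cancel_left _ (hswap _ _ h3 h1)).1 hmem

end SInf

theorem symIncl_apply_of_lt {r : ℕ} (s : Equiv.Perm (Fin r)) {i : ℕ} (hi : i < r) :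
    (symIncl r s : Equiv.Perm ℕ) i = s ⟨i, hi⟩ :=
  Equiv.Perm.extendDomain_apply_subtype s Fin.equivSubtype hi

theorem symIncl_apply_of_le {r : ℕ} (s : Equiv.Perm (Fin r)) {i : ℕ} (hi : r ≤ i) :
    (symIncl r s : Equiv.Perm ℕ) i = i :=
  Equiv.Perm.extendDomain_apply_not_subtype s Fin.equivSubtype (not_lt.2 hi)

theorem symIncl_mem_young {r : ℕ} (s : Equiv.Perm (Fin r)) : symIncl r s ∈ young r := by
  intro i
  rcases lt_or_ge i r with hi | hi
  · simp [symIncl_apply_of_lt s hi, hi]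
  · simp [symIncl_apply_of_le s hi]

theorem symIncl_youngProj_apply {r : ℕ} (g : young r) {i : ℕ} (hi : i < r) :
    (symIncl r (youngProj r g) : Equiv.Perm ℕ) i = ((g : SInf) : Equiv.Perm ℕ) i :=
  symIncl_apply_of_lt _ hi

theorem mem_young_iff {r : ℕ} (g : SInf) :
    g ∈ young r ↔ (Finset.range r).map (g : Equiv.Perm ℕ).toEmbedding = Finset.range r := by
  constructor
  · intro hg
    refine Finset.eq_of_subset_of_card_le (fun i hi => ?_) (by simp)
    obtain ⟨j, hj, rfl⟩ := Finset.mem_map.1 hi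
    exact Finset.mem_range.2 ((hg j).2 (Finset.mem_range.1 hj))
  · intro h i
    have := Finset.mem_map' (s := Finset.range r) (a := i) (g : Equiv.Perm ℕ).toEmbedding
    rw [h] at this
    simpa using this

/-! ### The spaces of vectors fixed by the stabilizers of finite sets -/

section FixedSpace

variable {H : Type*} [NormedAddCommGroup H] [InnerProductSpace ℂ H]
  (π : SInf →* (H ≃ₗᵢ[ℂ] H))

/-- The vectors fixed by all finite permutations that fix the points of `A`. -/
def fixedSpace (A : Finset ℕ) : Submodule ℂ H where
  carrier := {x | ∀ g : SInf, (∀ i ∈ A, (g : Equiv.Perm ℕ) i = i) → π g x = x}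
  zero_mem' := by simp
  add_mem' := fun hx hy g hg => by rw [map_add, hx g hg, hy g hg]
  smul_mem' := fun c x hx g hg => by rw [map_smul, hx g hg]

variable {π}

theorem rep_mul_apply {G : Type*} [Group G] (σ : G →* (H ≃ₗᵢ[ℂ] H)) (g h : G) (x : H) :
    σ (g * h) x = σ g (σ h x) := by
  rw [map_mul]; rfl

theorem rep_inv_apply_self {G : Type*} [Group G] (σ : G →* (H ≃ₗᵢ[ℂ] H)) (g : G) (x : H) :
    σ g⁻¹ (σ g x) = x := by
  rw [← rep_mul_apply, inv_mul_cancel, map_one]; rfl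

theorem rep_self_apply_inv {G : Type*} [Group G] (σ : G →* (H ≃ₗᵢ[ℂ] H)) (g : G) (x : H) :
    σ g (σ g⁻¹ x) = x := by
  rw [← rep_mul_apply, mul_inv_cancel, map_one]; rfl

theorem inner_rep_left {G : Type*} [Group G] (σ : G →* (H ≃ₗᵢ[ℂ] H)) (g : G) (x y : H) :
    inner ℂ (σ g x) y = inner ℂ x (σ g⁻¹ y) := by
  rw [← LinearIsometryEquiv.inner_map_map (σ g) x, rep_self_apply_inv]

theorem isClosed_fixedSpace (A : Finset ℕ) : IsClosed (fixedSpace π A : Set H) := by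
  have : (fixedSpace π A : Set H) =
      ⋂ (g : SInf) (_ : ∀ i ∈ A, (g : Equiv.Perm ℕ) i = i), {x | π g x = x} := by
    ext x
    simp only [Set.mem_iInter]
    rfl
  rw [this]
  exact isClosed_iInter fun g => isClosed_iInter fun _ =>
    isClosed_eq (π g).continuous continuous_id

theorem fixedSpace_mono {A B : Finset ℕ} (h : A ⊆ B) : fixedSpace π A ≤ fixedSpace π B :=
  fun _ hx g hg => hx g fun i hi => hg i (h hi)

/-- `h⁻¹ * g` fixes `A` pointwise. Later identities between operators reduce through this to
identities between maps on finite sets. -/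
theorem rep_congr {A : Finset ℕ} {x : H} (hx : x ∈ fixedSpace π A) {g h : SInf}
    (hgh : ∀ i ∈ A, (g : Equiv.Perm ℕ) i = (h : Equiv.Perm ℕ) i) : π g x = π h x := by
  have := hx (h⁻¹ * g) fun i hi => by
    rw [SInf.coe_mul_apply, SInf.coe_inv_apply_eq_iff, hgh i hi]
  rw [← rep_self_apply_inv π h (π g x), ← rep_mul_apply π h⁻¹, this]

theorem rep_mem_fixedSpace {A : Finset ℕ} {x : H} (hx : x ∈ fixedSpace π A) (g : SInf) :
    π g x ∈ fixedSpace π (A.map (g : Equiv.Perm ℕ).toEmbedding) := by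
  intro h hh
  rw [← rep_mul_apply]
  refine rep_congr hx fun i hi => ?_
  rw [SInf.coe_mul_apply]
  exact hh _ (Finset.mem_map_of_mem _ hi)

theorem map_inv_map (g : SInf) (A : Finset ℕ) :
    (A.map (g : Equiv.Perm ℕ).toEmbedding).map ((g⁻¹ : SInf) : Equiv.Perm ℕ).toEmbedding = A := by
  rw [Finset.map_map]
  convert Finset.map_refl
  ext i
  simp

theorem map_map_inv (g : SInf) (A : Finset ℕ) :
    (A.map ((g⁻¹ : SInf) : Equiv.Perm ℕ).toEmbedding).map (g : Equiv.Perm ℕ).toEmbedding = A := by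
  simpa using map_inv_map g⁻¹ A

/-- If `x` is fixed by the stabilizer of `A`, `y` by that of `B`, and `x` is orthogonal to the
vectors fixed by the stabilizer of `A ∩ B`, then `x` and `y` are orthogonal: the projections onto
the spaces `fixedSpace π A` and `fixedSpace π B` form a commuting square. -/
theorem inner_eq_zero_of_inter [CompleteSpace H] {A B : Finset ℕ} {x y : H}
    (hx : x ∈ fixedSpace π A) (hy : y ∈ fixedSpace π B)
    (hxy : x ∈ (fixedSpace π (A ∩ B))ᗮ) : inner ℂ y x = 0 := by
  have hex : ∀ k : ℕ, ∃ h : SInf, (∀ i ∈ A, (h : Equiv.Perm ℕ) i = i) ∧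
      ∀ i ∈ B, i ∉ A → k ≤ (h : Equiv.Perm ℕ) i := by
    intro k
    obtain ⟨M, hM⟩ := A.exists_nat_subset_range
    -- `M` bounds `A`, so the shifted points avoid `A` and the map is injective.
    obtain ⟨h, hh⟩ := SInf.exists_eqOn (A ∪ B) (fun i => if i ∈ A then i else i + (k + M)) (by
      intro i _ j _ hij
      have hA : ∀ i ∈ A, i < M := fun i hi => Finset.mem_range.1 (hM hi)
      by_cases hi : i ∈ A <;> by_cases hj : j ∈ A
      · simpa [hi, hj] using hij
      · have := hA i hi
        simp only [hi, hj, if_true, if_false] at hij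
        omega
      · have := hA j hj
        simp only [hi, hj, if_true, if_false] at hij
        omega
      · simpa [hi, hj] using hij)
    refine ⟨h, fun i hi => ?_, fun i hi hiA => ?_⟩
    · rw [hh i (Finset.mem_union_left _ hi), if_pos hi]
    · rw [hh i (Finset.mem_union_right _ hi), if_neg hiA]
      omega
  choose h hhA hhB using hex
  -- By weak-* compactness of balls, the vectors `π (h k) y` have a weak limit `w` along a
  -- nonprincipal ultrafilter.
  obtain ⟨φ, -, hφ⟩ := (WeakDual.isCompact_closedBall (𝕜 := ℂ) (E := H) 0 ‖y‖).ultrafilter_le_nhds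
    ((hyperfilter ℕ).map fun k => StrongDual.toWeakDual (InnerProductSpace.toDual ℂ H (π (h k) y)))
    (by
      rw [Ultrafilter.coe_map, le_principal_iff, mem_map]
      refine univ_mem' fun k => ?_
      simp)
  have hlim : ∀ z : H, Tendsto (fun k => inner ℂ (π (h k) y) z) (hyperfilter ℕ) (𝓝 (φ z)) :=
    fun z => (tendsto_iff_forall_eval_tendsto_topDualPairing.1 hφ) z
  obtain ⟨w, rfl⟩ : ∃ w : H, StrongDual.toWeakDual (InnerProductSpace.toDual ℂ H w) = φ :=
    ⟨(InnerProductSpace.toDual ℂ H).symm (WeakDual.toStrongDual φ), by simp⟩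
  replace hlim : ∀ z : H, Tendsto (fun k => inner ℂ (π (h k) y) z) (hyperfilter ℕ)
      (𝓝 (inner ℂ w z)) := hlim
  -- A given `g` moves finitely many points, so for large `k` it fixes `h k` of every point of `B`
  -- outside `A`; then `g * h k` and `h k` agree on `B`.
  have hw : w ∈ fixedSpace π (A ∩ B) := by
    intro g hg
    obtain ⟨N, hN⟩ := SInf.exists_bound g
    refine ext_inner_right ℂ fun z => ?_
    rw [inner_rep_left]
    refine tendsto_nhds_unique (hlim (π g⁻¹ z)) ((hlim z).congr' ?_)
    have hev : ∀ᶠ k in (hyperfilter ℕ : Filter ℕ), N ≤ k := by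
      refine hyperfilter_le_cofinite ?_
      rw [Nat.cofinite_eq_atTop]
      exact eventually_ge_atTop N
    filter_upwards [hev] with k hk
    rw [← inner_rep_left, ← rep_mul_apply]
    congr 1
    refine rep_congr hy fun i hi => ?_
    rw [SInf.coe_mul_apply]
    by_cases hiA : i ∈ A
    · rw [hhA k i hiA, hg i (Finset.mem_inter.2 ⟨hiA, hi⟩)]
    · exact (hN _ (hk.trans (hhB k i hi hiA))).symm
  -- `h k` fixes `A` pointwise, so `π (h k)` fixes `x`.
  have hconst : ∀ k, inner ℂ (π (h k) y) x = inner ℂ y x := by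
    intro k
    rw [inner_rep_left]
    congr 1
    conv_lhs => rw [← hx (h k) (hhA k)]
    exact rep_inv_apply_self π _ _
  have h1 := hlim x
  simp only [hconst, hxy w hw] at h1
  exact tendsto_nhds_unique tendsto_const_nhds h1

/-- Every neighbourhood of 1 in the pointwise topology contains the stabilizer of an initial
segment. -/
theorem exists_norm_rep_sub_lt (hπ : IsTame π) (x : H) {ε : ℝ} (hε : 0 < ε) :
    ∃ n, ∀ g : SInf, (∀ i < n, (g : Equiv.Perm ℕ) i = i) → ‖π g x - x‖ < ε := by
  let _ : TopologicalSpace SInf := SInf.pointwiseTopology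
  have h1 : ∀ᶠ g in 𝓝 (1 : SInf), ‖π g x - x‖ < ε := by
    have := ((hπ x).tendsto 1).sub_const x |>.norm
    simp only [map_one, LinearIsometryEquiv.coe_one, id_eq, sub_self, norm_zero] at this
    exact this.eventually (gt_mem_nhds hε)
  rw [nhds_induced, eventually_comap, nhds_pi, Filter.eventually_iff, Filter.mem_pi] at h1
  obtain ⟨I, hI, t, ht, hsub⟩ := h1
  obtain ⟨n, hn⟩ := hI.bddAbove
  refine ⟨n + 1, fun g hg => ?_⟩
  refine hsub (a := fun i => (g : Equiv.Perm ℕ) i) (fun i hi => ?_) g rfl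
  have : (g : Equiv.Perm ℕ) i = i := hg i (Nat.lt_succ_of_le (hn hi))
  have h1 := mem_of_mem_nhds (ht i)
  change (g : Equiv.Perm ℕ) i ∈ t i
  rwa [this]

theorem exists_mem_fixedSpace_norm_sub_le [CompleteSpace H] (hπ : IsTame π) (x : H) {ε : ℝ}
    (hε : 0 < ε) : ∃ n, ∃ y ∈ fixedSpace π (Finset.range n), ‖y - x‖ ≤ ε := by
  obtain ⟨n, hn⟩ := exists_norm_rep_sub_lt hπ x hε
  let O : Set H := {y | ∃ g : SInf, (∀ i < n, (g : Equiv.Perm ℕ) i = i) ∧ π g x = y}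
  let C : Set H := closure (convexHull ℝ O)
  have hCconv : Convex ℝ C := (convex_convexHull ℝ O).closure
  have hCcl : IsClosed C := isClosed_closure
  have hOC : O ⊆ C := (subset_convexHull ℝ O).trans subset_closure
  let _ : InnerProductSpace ℝ H := InnerProductSpace.complexToReal
  -- `v` is the point of `C` nearest to 0. As `C` is invariant under the stabilizer, uniqueness of
  -- this point makes `v` fixed.
  obtain ⟨v, hvC, hv⟩ := exists_norm_eq_iInf_of_complete_convex
    ⟨x, hOC ⟨1, by simp, by simp⟩⟩ hCcl.isComplete hCconv 0
  refine ⟨n, v, fun g hg => ?_, ?_⟩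
  · have hgC : π g v ∈ C := by
      have hmaps : Set.MapsTo (π g) (convexHull ℝ O) (convexHull ℝ O) := by
        have := (π g).toLinearEquiv.toLinearMap.restrictScalars ℝ |>.image_convexHull O
        intro z hz
        have hz' : π g z ∈ convexHull ℝ (π g '' O) := by
          rw [show (π g '' O) = ((π g).toLinearEquiv.toLinearMap.restrictScalars ℝ) '' O from rfl,
            ← this]
          exact ⟨z, hz, rfl⟩
        refine convexHull_mono ?_ hz'
        rintro _ ⟨_, ⟨h, hh, rfl⟩, rfl⟩
        refine ⟨g * h, fun i hi => ?_, rep_mul_apply π g h x⟩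
        rw [SInf.coe_mul_apply, hh i hi, hg i (Finset.mem_range.2 hi)]
      exact hmaps.closure (π g).continuous hvC
    have h1 := (norm_eq_iInf_iff_real_inner_le_zero hCconv hvC).1 hv _ hgC
    have h2 := (norm_eq_iInf_iff_real_inner_le_zero (u := 0) hCconv hgC).1 (by
      rw [← hv]; simp) _ hvC
    -- The variational inequalities at the two minimizers `v` and `π g v`, each tested on the other,
    -- add up to this.
    have h3 : inner ℝ (π g v - v) (π g v - v) ≤ 0 := by
      simp only [zero_sub, inner_neg_left, inner_sub_right, inner_sub_left] at h1 h2 ⊢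
      linarith
    exact sub_eq_zero.1 (real_inner_self_nonpos.1 h3)
  · have hball : C ⊆ Metric.closedBall x ε := by
      refine closure_minimal (convexHull_min ?_ (convex_closedBall x ε)) Metric.isClosed_closedBall
      rintro _ ⟨g, hg, rfl⟩
      rw [mem_closedBall_iff_norm]
      exact (hn g hg).le
    exact mem_closedBall_iff_norm.1 (hball hvC)

end FixedSpace

/-! ### The canonical semi-cosimplicial Hilbert space -/

/-- The increasing injection `ℕ → ℕ` that omits the value `i`. -/
def skip (i j : ℕ) : ℕ := if j < i then j else j + 1

theorem skip_of_lt {i j : ℕ} (h : j < i) : skip i j = j := if_pos h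

theorem skip_of_le {i j : ℕ} (h : i ≤ j) : skip i j = j + 1 := if_neg (not_lt.2 h)

theorem strictMono_skip (i : ℕ) : StrictMono (skip i) := by
  intro a b hab
  unfold skip
  split_ifs <;> omega

theorem skip_injective (i : ℕ) : Function.Injective (skip i) := (strictMono_skip i).injective

theorem mem_range_skip {i j : ℕ} : j ∈ Set.range (skip i) ↔ j ≠ i := by
  constructor
  · rintro ⟨k, rfl⟩
    unfold skip
    split_ifs <;> omega
  · intro h
    rcases lt_or_gt_of_ne h with h | h
    · exact ⟨j, skip_of_lt h⟩
    · exact ⟨j - 1, by rw [skip_of_le (by omega)]; omega⟩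

theorem skip_lt {i j n : ℕ} (h : j < n) : skip i j < n + 1 := by
  unfold skip
  split_ifs <;> omega

theorem skip_skip {i j : ℕ} (hij : i < j) (k : ℕ) :
    skip j (skip i k) = skip i (skip (j - 1) k) := by
  unfold skip
  split_ifs <;> omega

/-- The product is the cycle that moves `i, …, i + m - 1` up by one and sends `i + m` back to `i`.
The latter value is not recorded, as it plays no role in the limit. -/
theorem coxeter_prod_apply (i m : ℕ) :
    (∀ j < i + m, ((((List.range' i m).map coxeter).prod : SInf) : Equiv.Perm ℕ) j = skip i j) ∧
      ∀ j, i + m < j → ((((List.range' i m).map coxeter).prod : SInf) : Equiv.Perm ℕ) j = j := by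
  induction m with
  | zero => exact ⟨fun j hj => (skip_of_lt hj).symm, fun j _ => by simp⟩
  | succ m ih =>
    rw [List.range'_concat, List.map_append, List.prod_append]
    simp only [List.map_cons, List.map_nil, List.prod_singleton, one_mul,
      SInf.coe_mul_apply, SInf.coe_coxeter]
    refine ⟨fun j hj => ?_, fun j hj => ?_⟩
    · rcases eq_or_lt_of_le (Nat.lt_succ_iff.1 (show j < (i + m) + 1 by omega)) with rfl | h
      · rw [Equiv.swap_apply_left, ih.2 _ (by omega), skip_of_le (by omega)]
      · rw [Equiv.swap_apply_of_ne_of_ne (by omega) (by omega), ih.1 j h]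
    · rw [Equiv.swap_apply_of_ne_of_ne (by omega) (by omega), ih.2 j (by omega)]

section Construction

variable {H : Type*} [NormedAddCommGroup H] [InnerProductSpace ℂ H]
  {π : SInf →* (H ≃ₗᵢ[ℂ] H)}

theorem mem_fixedSpace_range_iff {n : ℕ} {x : H} :
    x ∈ fixedSpace π (Finset.range n) ↔ ∀ k, n ≤ k → π (coxeter k) x = x := by
  constructor
  · intro hx k hk
    refine hx _ fun i hi => ?_
    have := Finset.mem_range.1 hi
    rw [SInf.coe_coxeter, Equiv.swap_apply_of_ne_of_ne (by omega) (by omega)]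
  · intro hx g hg
    let P : Subgroup SInf :=
      { carrier := {g | π g x = x}
        one_mem' := by simp
        mul_mem' := fun {a b} ha hb => by
          rw [Set.mem_ofPred_eq] at ha hb ⊢
          rw [rep_mul_apply, hb, ha]
        inv_mem' := fun {a} ha => by
          rw [Set.mem_ofPred_eq] at ha ⊢
          conv_lhs => rw [← ha]
          exact rep_inv_apply_self π a x }
    exact SInf.mem_of_coxeter_mem (P := P) hx g fun i hi => hg i (Finset.mem_range.2 hi)

/-- The isometry `T` acts on vectors of finite level like permutations that agree with `f` on
large finite sets. -/
def Implements (π : SInf →* (H ≃ₗᵢ[ℂ] H)) (T : H →ₗᵢ[ℂ] H) (f : ℕ → ℕ) : Prop :=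
  ∀ n, ∀ x ∈ fixedSpace π (Finset.range n), ∀ g : SInf,
    (∀ j < n, (g : Equiv.Perm ℕ) j = f j) → T x = π g x

theorem implements_id : Implements π LinearIsometry.id id := fun _ _ hx _ hg =>
  (hx _ fun i hi => hg i (Finset.mem_range.1 hi)).symm

/-- `T` sends a vector of finite level to one of possibly higher finite level, where `S` is again
given by a permutation; multiply the two permutations. -/
theorem Implements.comp {S T : H →ₗᵢ[ℂ] H} {f g : ℕ → ℕ} (hS : Implements π S f)
    (hf : Function.Injective f) (hT : Implements π T g) (hg : Function.Injective g) :
    Implements π (S.comp T) (f ∘ g) := by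
  intro n x hx k hk
  obtain ⟨b, hb⟩ := SInf.exists_eqOn (Finset.range n) g hg.injOn
  obtain ⟨N, hN⟩ := ((Finset.range n).map (b : Equiv.Perm ℕ).toEmbedding).exists_nat_subset_range
  obtain ⟨a, ha⟩ := SInf.exists_eqOn (Finset.range N) f hf.injOn
  change S (T x) = _
  rw [hT n x hx b fun j hj => hb j (Finset.mem_range.2 hj),
    hS N _ (fixedSpace_mono hN (rep_mem_fixedSpace hx b)) a
      fun j hj => ha j (Finset.mem_range.2 hj), ← rep_mul_apply]
  refine rep_congr hx fun i hi => ?_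
  have h1 := ha _ (hN (Finset.mem_map_of_mem _ hi))
  rw [Equiv.coe_toEmbedding] at h1
  rw [SInf.coe_mul_apply, h1, hb i hi,
    hk i (Finset.mem_range.1 hi)]
  rfl

/-- Vectors of finite level are dense. Relations between shifts thereby follow from relations
between injections of ℕ. -/
theorem Implements.ext [CompleteSpace H] (hπ : IsTame π) {S T : H →ₗᵢ[ℂ] H} {f : ℕ → ℕ}
    (hf : Function.Injective f) (hS : Implements π S f) (hT : Implements π T f) : S = T := by
  have hd : Dense {x | ∃ n, x ∈ fixedSpace π (Finset.range n)} := by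
    refine Metric.dense_iff.2 fun x ε hε => ?_
    obtain ⟨n, y, hy, hyx⟩ := exists_mem_fixedSpace_norm_sub_le hπ x (half_pos hε)
    refine ⟨y, mem_ball_iff_norm.2 (by linarith), n, hy⟩
  refine LinearIsometry.ext fun x => ?_
  refine congrFun (Continuous.ext_on hd S.continuous T.continuous ?_) x
  rintro y ⟨n, hy⟩
  obtain ⟨g, hg⟩ := SInf.exists_eqOn (Finset.range n) f hf.injOn
  have hg' : ∀ j < n, (g : Equiv.Perm ℕ) j = f j := fun j hj => hg j (Finset.mem_range.2 hj)
  rw [hS n y hy g hg', hT n y hy g hg']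

theorem rep_coxeter_prod_eq {n i m : ℕ} {x : H} (hx : x ∈ fixedSpace π (Finset.range n))
    (hm : n ≤ m) {g : SInf} (hg : ∀ j < n, (g : Equiv.Perm ℕ) j = skip i j) :
    π (((List.range' i m).map coxeter).prod) x = π g x :=
  rep_congr hx fun j hj => by
    have := Finset.mem_range.1 hj
    rw [(coxeter_prod_apply i m).1 j (by omega), hg j this]

/-- On a vector of level `n` the sequence is constant from `m = n` on; an ε/3-approximation by such
a vector gives the Cauchy property. -/
theorem exists_tendsto_coxeter_prod [CompleteSpace H] (hπ : IsTame π) (i : ℕ) (x : H) :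
    ∃ y, Tendsto (fun m : ℕ => π (((List.range' i m).map coxeter).prod) x) atTop (𝓝 y) := by
  refine cauchySeq_tendsto_of_complete (Metric.cauchySeq_iff'.2 fun ε hε => ?_)
  obtain ⟨n, y, hy, hyx⟩ := exists_mem_fixedSpace_norm_sub_le hπ x (ε := ε / 3) (by positivity)
  refine ⟨n, fun m hm => ?_⟩
  obtain ⟨g, hg⟩ := SInf.exists_eqOn (Finset.range n) (skip i) (skip_injective i).injOn
  have hg' : ∀ j < n, (g : Equiv.Perm ℕ) j = skip i j := fun j hj => hg j (Finset.mem_range.2 hj)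
  have h1 : ∀ m, n ≤ m → dist (π (((List.range' i m).map coxeter).prod) x) (π g y) ≤ ε / 3 := by
    intro m hm
    rw [← rep_coxeter_prod_eq hy hm hg', LinearIsometryEquiv.dist_map, dist_comm, dist_eq_norm]
    exact hyx
  calc _ ≤ _ := dist_triangle_right _ _ (π g y)
    _ ≤ ε / 3 + ε / 3 := add_le_add (h1 m hm) (h1 n le_rfl)
    _ < ε := by linarith

/-- The partial shift `α_i`, the strong limit of the products of consecutive generators. -/
noncomputable def limitShift [CompleteSpace H] (hπ : IsTame π) (i : ℕ) : H →ₗᵢ[ℂ] H where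
  toFun x := (exists_tendsto_coxeter_prod hπ i x).choose
  map_add' x y := by
    refine tendsto_nhds_unique (exists_tendsto_coxeter_prod hπ i (x + y)).choose_spec ?_
    simp only [map_add]
    exact (exists_tendsto_coxeter_prod hπ i x).choose_spec.add
      (exists_tendsto_coxeter_prod hπ i y).choose_spec
  map_smul' c x := by
    refine tendsto_nhds_unique (exists_tendsto_coxeter_prod hπ i (c • x)).choose_spec ?_
    simp only [map_smul]
    exact (exists_tendsto_coxeter_prod hπ i x).choose_spec.const_smul c
  norm_map' x := by
    refine tendsto_nhds_unique (exists_tendsto_coxeter_prod hπ i x).choose_spec.norm ?_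
    simp only [LinearIsometryEquiv.norm_map]
    exact tendsto_const_nhds

theorem tendsto_limitShift [CompleteSpace H] (hπ : IsTame π) (i : ℕ) (x : H) :
    Tendsto (fun m : ℕ => π (((List.range' i m).map coxeter).prod) x) atTop
      (𝓝 (limitShift hπ i x)) :=
  (exists_tendsto_coxeter_prod hπ i x).choose_spec

theorem implements_of_tendsto {T : H →ₗᵢ[ℂ] H} {i : ℕ}
    (hT : ∀ x, Tendsto (fun m : ℕ => π (((List.range' i m).map coxeter).prod) x) atTop (𝓝 (T x))) :
    Implements π T (skip i) := by
  intro n x hx g hg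
  refine tendsto_nhds_unique (hT x) (tendsto_const_nhds.congr' ?_)
  filter_upwards [eventually_ge_atTop n] with m hm
  exact (rep_coxeter_prod_eq hx hm hg).symm

theorem Implements.mem_fixedSpace {T : H →ₗᵢ[ℂ] H} {i n : ℕ} (hT : Implements π T (skip i)) {x : H}
    (hx : x ∈ fixedSpace π (Finset.range n)) : T x ∈ fixedSpace π (Finset.range (n + 1)) := by
  obtain ⟨g, hg⟩ := SInf.exists_eqOn (Finset.range n) (skip i) (skip_injective i).injOn
  rw [hT n x hx g fun j hj => hg j (Finset.mem_range.2 hj)]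
  refine fixedSpace_mono ?_ (rep_mem_fixedSpace hx g)
  intro j hj
  obtain ⟨k, hk, rfl⟩ := Finset.mem_map.1 hj
  exact Finset.mem_range.2 (lt_of_eq_of_lt (hg k hk) (skip_lt (Finset.mem_range.1 hk)))

/-- The canonical semi-cosimplicial Hilbert space of a tame representation. -/
noncomputable def canonicalSCH [CompleteSpace H] (hπ : IsTame π) : SCH H where
  tower n := fixedSpace π (Finset.range n)
  shift := limitShift hπ
  isClosed_tower n := isClosed_fixedSpace _
  tower_mono _ _ h := fixedSpace_mono (Finset.range_mono h)
  dense := by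
    refine eq_top_iff.2 fun x _ => Metric.mem_closure_iff.2 fun ε hε => ?_
    obtain ⟨n, y, hy, hyx⟩ := exists_mem_fixedSpace_norm_sub_le hπ x (half_pos hε)
    refine ⟨y, Submodule.mem_iSup_of_mem n hy, ?_⟩
    rw [dist_comm, dist_eq_norm]
    linarith
  adapted i n x hx := (implements_of_tendsto (tendsto_limitShift hπ i)).mem_fixedSpace hx
  fixed n x hx := by
    -- `skip n` is the identity below `n`, so the permutation 1 implements the shift here.
    rw [implements_of_tendsto (tendsto_limitShift hπ n) n x hx 1 fun j hj => (skip_of_lt hj).symm,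
      map_one]
    rfl
  cosimplicial i j hij x := by
    have h : ∀ i, Implements π (limitShift hπ i) (skip i) := fun i =>
      implements_of_tendsto (tendsto_limitShift hπ i)
    have h1 := (h j).comp (skip_injective j) (h i) (skip_injective i)
    have h2 := (h i).comp (skip_injective i) (h (j - 1)) (skip_injective (j - 1))
    rw [show skip i ∘ skip (j - 1) = skip j ∘ skip i from
      funext fun k => (skip_skip hij k).symm] at h2
    exact DFunLike.congr_fun
      (h1.ext hπ ((skip_injective j).comp (skip_injective i)) h2) x

theorem isCanonical_canonicalSCH [CompleteSpace H] (hπ : IsTame π) :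
    (canonicalSCH hπ).IsCanonical π :=
  ⟨fun _ _ => mem_fixedSpace_range_iff, tendsto_limitShift hπ⟩

end Construction

/-! ### Normality and the labeled subspaces -/

section Pure

variable {H : Type*} [NormedAddCommGroup H] [InnerProductSpace ℂ H]
  {π : SInf →* (H ≃ₗᵢ[ℂ] H)}

theorem rep_mem_orthogonal_fixedSpace {A : Finset ℕ} {x : H} (hx : x ∈ (fixedSpace π A)ᗮ)
    (g : SInf) : π g x ∈ (fixedSpace π (A.map (g : Equiv.Perm ℕ).toEmbedding))ᗮ := by
  intro y hy
  rw [← inv_inv g, ← inner_rep_left]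
  refine hx _ ?_
  have := rep_mem_fixedSpace hy g⁻¹
  rwa [map_inv_map] at this

theorem map_fixedSpace (g : SInf) (A : Finset ℕ) :
    (fixedSpace π A).map (π g).toLinearEquiv.toLinearMap =
      fixedSpace π (A.map (g : Equiv.Perm ℕ).toEmbedding) := by
  ext x
  constructor
  · rintro ⟨y, hy, rfl⟩
    exact rep_mem_fixedSpace hy g
  · intro hx
    refine ⟨π g⁻¹ x, ?_, rep_self_apply_inv π g x⟩
    have := rep_mem_fixedSpace hx g⁻¹
    rwa [map_inv_map] at this

variable (π) in
/-- The vectors fixed by the stabilizer of `A` that are orthogonal to those fixed by the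
stabilizer of a proper subset of `A`. -/
noncomputable def pureSpace (A : Finset ℕ) : Submodule ℂ H :=
  fixedSpace π A ⊓ ⨅ B ∈ A.ssubsets, (fixedSpace π B)ᗮ

theorem mem_pureSpace {A : Finset ℕ} {x : H} :
    x ∈ pureSpace π A ↔ x ∈ fixedSpace π A ∧ ∀ B, B ⊂ A → x ∈ (fixedSpace π B)ᗮ := by
  simp [pureSpace, Submodule.mem_iInf]

theorem pureSpace_le (A : Finset ℕ) : pureSpace π A ≤ fixedSpace π A := inf_le_left

theorem isClosed_pureSpace (A : Finset ℕ) : IsClosed (pureSpace π A : Set H) := by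
  simp only [pureSpace, Submodule.coe_inf, Submodule.coe_iInf]
  exact (isClosed_fixedSpace A).inter
    (isClosed_iInter fun B => isClosed_iInter fun _ => Submodule.isClosed_orthogonal _)

theorem rep_mem_pureSpace {A : Finset ℕ} {x : H} (hx : x ∈ pureSpace π A) (g : SInf) :
    π g x ∈ pureSpace π (A.map (g : Equiv.Perm ℕ).toEmbedding) := by
  rw [mem_pureSpace] at hx ⊢
  refine ⟨rep_mem_fixedSpace hx.1 g, fun B hB => ?_⟩
  have hB' : B.map ((g⁻¹ : SInf) : Equiv.Perm ℕ).toEmbedding ⊂ A := by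
    rw [← map_inv_map g A]
    exact Finset.map_ssubset_map.2 hB
  have := rep_mem_orthogonal_fixedSpace (hx.2 _ hB') g
  rwa [map_map_inv] at this

theorem map_pureSpace (g : SInf) (A : Finset ℕ) :
    (pureSpace π A).map (π g).toLinearEquiv.toLinearMap =
      pureSpace π (A.map (g : Equiv.Perm ℕ).toEmbedding) := by
  ext x
  constructor
  · rintro ⟨y, hy, rfl⟩
    exact rep_mem_pureSpace hy g
  · intro hx
    refine ⟨π g⁻¹ x, ?_, rep_self_apply_inv π g x⟩
    have := rep_mem_pureSpace hx g⁻¹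
    rwa [map_inv_map] at this

/-- `A ∩ B` is a proper subset of `A` or of `B`. The corresponding vector is orthogonal to
`fixedSpace π (A ∩ B)`, and the commuting square applies. -/
theorem inner_pureSpace_eq_zero [CompleteSpace H] {A B : Finset ℕ} (hAB : A ≠ B) {x y : H}
    (hx : x ∈ pureSpace π A) (hy : y ∈ pureSpace π B) : inner ℂ x y = 0 := by
  by_cases h : A ∩ B = B
  · have h' : B ∩ A ⊂ A := by
      refine (Finset.inter_subset_right).ssubset_of_ne fun h2 => hAB ?_
      rw [← h2, Finset.inter_comm, h]
    rw [inner_eq_zero_symm]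
    exact inner_eq_zero_of_inter (mem_pureSpace.1 hx).1 (mem_pureSpace.1 hy).1
      (Finset.inter_comm A B ▸ (mem_pureSpace.1 hx).2 _ h')
  · have h' : B ∩ A ⊂ B :=
      (Finset.inter_subset_left).ssubset_of_ne fun h2 => h (Finset.inter_comm A B ▸ h2)
    exact inner_eq_zero_of_inter (mem_pureSpace.1 hy).1 (mem_pureSpace.1 hx).1
      ((mem_pureSpace.1 hy).2 _ h')

/-- Project onto the closed span `N` of the fixed spaces of proper subsets: the projection is
covered by induction, and the remainder is pure. -/
theorem fixedSpace_le_closure_iSup_pureSpace [CompleteSpace H] (A : Finset ℕ) :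
    fixedSpace π A ≤ (⨆ B : {B : Finset ℕ // B ⊆ A}, pureSpace π B).topologicalClosure := by
  induction A using Finset.strongInduction with
  | H A ih =>
    set M := (⨆ B : {B : Finset ℕ // B ⊆ A}, pureSpace π B).topologicalClosure with hM
    set N := (⨆ B : {B : Finset ℕ // B ⊂ A}, fixedSpace π B).topologicalClosure with hN
    have hNM : N ≤ M := by
      refine Submodule.topologicalClosure_minimal _ (iSup_le fun B => (ih B B.2).trans ?_)
        (Submodule.isClosed_topologicalClosure _)
      refine Submodule.topologicalClosure_mono (iSup_le fun C => ?_)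
      exact le_iSup (fun B : {B : Finset ℕ // B ⊆ A} => pureSpace π (B : Finset ℕ))
        ⟨C, C.2.trans B.2.1⟩
    have hNA : N ≤ fixedSpace π A :=
      Submodule.topologicalClosure_minimal _ (iSup_le fun B => fixedSpace_mono B.2.1)
        (isClosed_fixedSpace A)
    have : CompleteSpace N := (Submodule.isClosed_topologicalClosure _).completeSpace_coe
    intro x hx
    have hp : N.starProjection x ∈ N := N.starProjection_apply_mem x
    rw [← sub_add_cancel x (N.starProjection x)]
    refine M.add_mem ?_ (hNM hp)
    refine Submodule.le_topologicalClosure _ (Submodule.mem_iSup_of_mem ⟨A, subset_rfl⟩ ?_)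
    rw [mem_pureSpace]
    refine ⟨Submodule.sub_mem _ hx (hNA hp), fun B hB => ?_⟩
    refine Submodule.orthogonal_le ?_ (N.sub_starProjection_mem_orthogonal x)
    exact (le_iSup (fun B : {B : Finset ℕ // B ⊂ A} => fixedSpace π (B : Finset ℕ)) ⟨B, hB⟩).trans
      (Submodule.le_topologicalClosure _)

end Pure

/-! ### Increasing injections attached to labels -/

theorem map_range_skip {i n : ℕ} (hi : i ≤ n) {g : SInf}
    (hg : ∀ j ∈ Finset.range n, (g : Equiv.Perm ℕ) j = skip i j) :
    (Finset.range n).map (g : Equiv.Perm ℕ).toEmbedding = (Finset.range (n + 1)).erase i := by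
  refine Finset.eq_of_subset_of_card_le (fun j hj => ?_) ?_
  · obtain ⟨k, hk, rfl⟩ := Finset.mem_map.1 hj
    change (g : Equiv.Perm ℕ) k ∈ _
    rw [hg k hk, Finset.mem_erase, Finset.mem_range]
    exact ⟨mem_range_skip.1 ⟨k, rfl⟩, skip_lt (Finset.mem_range.1 hk)⟩
  · rw [Finset.card_erase_of_mem (Finset.mem_range.2 (Nat.lt_succ_of_le hi))]
    simp

/-- The composition of the injections `skip i` over a list; the last entry is applied last. -/
def skipList (l : List ℕ) : ℕ → ℕ := l.foldl (fun f i => skip i ∘ f) id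

theorem skipList_concat (l : List ℕ) (i : ℕ) : skipList (l ++ [i]) = skip i ∘ skipList l := by
  simp [skipList]

theorem strictMono_skipList (l : List ℕ) : StrictMono (skipList l) := by
  induction l using List.reverseRecOn with
  | nil => exact strictMono_id
  | append_singleton l i ih => exact skipList_concat l i ▸ (strictMono_skip i).comp ih

/-- As the list increases, each later `skip i` fixes all smaller values, so those omitted earlier
stay omitted. -/
theorem mem_range_skipList {l : List ℕ} (hl : l.Pairwise (· < ·)) {j : ℕ} :
    j ∈ Set.range (skipList l) ↔ j ∉ l := by
  induction l using List.reverseRecOn generalizing j with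
  | nil => simp [skipList]
  | append_singleton l i ih =>
    rw [List.pairwise_append] at hl
    obtain ⟨h1, -, h2⟩ := hl
    rw [skipList_concat, Set.range_comp]
    constructor
    · rintro ⟨k, hk, rfl⟩ hmem
      rw [ih h1] at hk
      rcases List.mem_append.1 hmem with h | h
      · have := h2 _ h i (by simp)
        refine hk ?_
        unfold skip at h this
        split_ifs at h this with h3
        · exact h
        · omega
      · exact mem_range_skip.1 ⟨k, rfl⟩ (by simpa using h)
    · intro hmem
      rw [List.mem_append, not_or, List.mem_singleton] at hmem
      obtain ⟨k, rfl⟩ := mem_range_skip.2 hmem.2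
      refine ⟨k, (ih h1).2 fun hk => ?_, rfl⟩
      have := h2 k hk i (by simp)
      rw [skip_of_lt this] at hmem
      exact hmem.1 hk

/-- The injection is increasing, and its range is `A` together with everything above the level of
`A`; so its first `A.card` values are `A`. The bound `A.sup (· + 1)` is the level plus one, and 0
for the empty label. -/
theorem image_skipList_range (A : Finset ℕ) :
    (Finset.range A.card).image
      (skipList ((Finset.range (A.sup (· + 1)) \ A).sort (· ≤ ·))) = A := by
  set l := (Finset.range (A.sup (· + 1)) \ A).sort (· ≤ ·) with hl
  have hrange : ∀ j, j ∈ Set.range (skipList l) ↔ (j < A.sup (· + 1) → j ∈ A) := by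
    intro j
    rw [mem_range_skipList (Finset.sortedLT_sort _).pairwise, Finset.mem_sort]
    simp
  have hlt : ∀ a ∈ A, a < A.sup (· + 1) := fun a ha => Finset.le_sup (f := (· + 1)) ha
  refine Finset.eq_of_subset_of_card_le (fun a ha => ?_) ?_
  · obtain ⟨j, hj, rfl⟩ := Finset.mem_image.1 ha
    -- A value outside `A` exceeds all of `A`, so `A` would be attained on `Finset.range j` with `j
    -- < A.card`.
    by_contra hA
    have h1 : A.sup (· + 1) ≤ skipList l j := by
      by_contra h
      exact hA ((hrange _).1 ⟨j, rfl⟩ (not_le.1 h))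
    have h2 : A ⊆ (Finset.range j).image (skipList l) := by
      intro a ha
      obtain ⟨i, rfl⟩ := (hrange a).2 fun _ => ha
      refine Finset.mem_image_of_mem _ (Finset.mem_range.2 ?_)
      exact (strictMono_skipList l).lt_iff_lt.1 ((hlt _ ha).trans_le h1)
    have h3 := (Finset.card_le_card h2).trans Finset.card_image_le
    rw [Finset.card_range] at h3
    exact absurd (Finset.mem_range.1 hj) (not_lt.2 h3)
  · rw [Finset.card_image_of_injective _ (strictMono_skipList l).injective, Finset.card_range]

/-! ### Cofaces, root spaces and labeled subspaces in terms of fixed and pure spaces -/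

namespace SCH.IsCanonical

variable {H : Type*} [NormedAddCommGroup H] [InnerProductSpace ℂ H]
  {π : SInf →* (H ≃ₗᵢ[ℂ] H)} {S : SCH H} (hS : S.IsCanonical π)
include hS

theorem tower_eq (n : ℕ) : S.tower n = fixedSpace π (Finset.range n) := by
  ext x
  rw [hS.1, mem_fixedSpace_range_iff]

theorem implements_shift (i : ℕ) : Implements π (S.shift i) (skip i) :=
  implements_of_tendsto (hS.2 i)

theorem exists_shift_eq (i n : ℕ) :
    ∃ g : SInf, (∀ j ∈ Finset.range n, (g : Equiv.Perm ℕ) j = skip i j) ∧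
      ∀ x ∈ S.tower n, S.shift i x = π g x := by
  obtain ⟨g, hg⟩ := SInf.exists_eqOn (Finset.range n) (skip i) (skip_injective i).injOn
  refine ⟨g, hg, fun x hx => ?_⟩
  exact hS.implements_shift i n x (hS.tower_eq n ▸ hx) g fun j hj => hg j (Finset.mem_range.2 hj)

/-- At this level the shift acts as a permutation that carries `{0, …, n-1}` onto `{0, …, n}`
without `i`. -/
theorem map_shift_tower {i n : ℕ} (hi : i ≤ n) :
    (S.tower n).map (S.shift i).toLinearMap =
      fixedSpace π ((Finset.range (n + 1)).erase i) := by
  obtain ⟨g, hg, hgS⟩ := hS.exists_shift_eq i n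
  rw [← map_range_skip hi hg, ← map_fixedSpace, ← hS.tower_eq]
  ext x
  constructor
  · rintro ⟨y, hy, rfl⟩
    exact ⟨y, hy, (hgS y hy).symm⟩
  · rintro ⟨y, hy, rfl⟩
    exact ⟨y, hy, hgS y hy⟩

theorem isNormal [CompleteSpace H] : S.IsNormal := by
  intro n i j hij hj
  refine ContinuousLinearMap.ext fun x => ext_inner_left ℂ fun y => ?_
  rw [ContinuousLinearMap.comp_apply, ContinuousLinearMap.comp_apply,
    ContinuousLinearMap.adjoint_inner_right]
  set d := ContinuousLinearMap.adjoint (S.coface i n) x with hd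
  change inner ℂ (y : H) (S.shift (j - 1) d) = inner ℂ (S.shift i y) (S.shift j x)
  -- After applying α_i, the claim is that α_i y is orthogonal to α_j z, where `z` is the part of
  -- `x` orthogonal to the image of δ_i.
  rw [← (S.shift i).inner_map_map, ← S.cosimplicial i j hij, ← sub_eq_zero, ← inner_sub_right,
    ← map_sub, inner_eq_zero_symm, ← neg_sub, map_neg, inner_neg_left, neg_eq_zero,
    inner_eq_zero_symm]
  set z : H := x - S.shift i d with hz
  have hzt : z ∈ S.tower (n + 1) := Submodule.sub_mem _ x.2 (S.adapted i n d d.2)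
  have hzo : z ∈ (fixedSpace π ((Finset.range (n + 1)).erase i))ᗮ := by
    rw [← hS.map_shift_tower (by omega)]
    rintro _ ⟨e, he, rfl⟩
    have h1 : inner ℂ (S.shift i e) (x : H) = inner ℂ e (d : H) :=
      (ContinuousLinearMap.adjoint_inner_right (S.coface i n) ⟨e, he⟩ x).symm
    change inner ℂ (S.shift i e) z = 0
    rw [hz, inner_sub_right, h1, (S.shift i).inner_map_map, sub_self]
  obtain ⟨h, hh, hhS⟩ := hS.exists_shift_eq j (n + 1)
  have hy : S.shift i y ∈ fixedSpace π ((Finset.range (n + 2)).erase i) := by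
    rw [← hS.map_shift_tower (by omega)]
    exact ⟨y, y.2, rfl⟩
  have hz1 : S.shift j z ∈ fixedSpace π ((Finset.range (n + 2)).erase j) := by
    rw [← hS.map_shift_tower hj]
    exact ⟨z, hzt, rfl⟩
  refine inner_eq_zero_of_inter hz1 hy ?_
  rw [hhS z hzt]
  -- `{0, …, n+1}` without `i` and `j` is the image under `skip j` of `{0, …, n}` without `i`,
  -- because `skip j` fixes `i < j`.
  refine Submodule.orthogonal_le (fixedSpace_mono ?_) (rep_mem_orthogonal_fixedSpace hzo h)
  intro k hk
  simp only [Finset.mem_inter, Finset.mem_erase, Finset.mem_range] at hk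
  obtain ⟨l, rfl⟩ := mem_range_skip.2 hk.1.1
  have hl : l < n + 1 := by
    have := hk.1.2
    unfold skip at this
    split_ifs at this <;> omega
  refine Finset.mem_map.2 ⟨l, Finset.mem_erase.2 ⟨?_, Finset.mem_range.2 hl⟩,
    hh l (Finset.mem_range.2 hl)⟩
  rintro rfl
  exact hk.2.1 (skip_of_lt hij)

/-- In rank `r + 1`, a proper subset of the initial segment misses some `i ≤ r`, so its fixed space
lies in the image of α_i. -/
theorem rootSpace_eq (r : ℕ) : S.rootSpace r = pureSpace π (Finset.range r) := by
  cases r with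
  | zero =>
    ext x
    rw [mem_pureSpace, rootSpace, hS.tower_eq]
    exact ⟨fun h => ⟨h, fun B hB => absurd hB (by simp)⟩, fun h => h.1⟩
  | succ r =>
    ext x
    rw [mem_pureSpace, rootSpace, Submodule.mem_inf, hS.tower_eq (r + 1), Submodule.mem_iInf]
    refine and_congr_right fun _ => ⟨fun h B hB => ?_, fun h i => ?_⟩
    · obtain ⟨i, hi, hiB⟩ := Finset.exists_of_ssubset hB
      have h1 := h i
      rw [hS.map_shift_tower (Nat.lt_succ_iff.1 (Finset.mem_range.1 hi))] at h1
      refine Submodule.orthogonal_le (fixedSpace_mono ?_) h1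
      exact fun k hk => Finset.mem_erase.2 ⟨fun h => hiB (h ▸ hk), hB.1 hk⟩
    · rcases le_or_gt i r with hi | hi
      · rw [hS.map_shift_tower hi]
        exact h _ (Finset.erase_ssubset (Finset.mem_range.2 (Nat.lt_succ_of_le hi)))
      -- For `i > r` the shift is the identity on `S.tower r`, which is the fixed space of a proper
      -- subset.
      · refine Submodule.orthogonal_le ?_ (h (Finset.range r) ?_)
        · rintro _ ⟨y, hy, rfl⟩
          rw [← hS.tower_eq]
          have := S.fixed i y (S.tower_mono hi.le hy)
          exact (show S.shift i y = y from this).symm ▸ hy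
        · exact (Finset.range_mono (Nat.le_succ r)).ssubset_of_ne fun h => by
            simpa using congrArg Finset.card h

theorem implements_labelShift (A : Finset ℕ) : Implements π (S.labelShift A)
    (skipList ((Finset.range (A.sup (· + 1)) \ A).sort (· ≤ ·))) := by
  unfold labelShift
  generalize (Finset.range (A.sup (· + 1)) \ A).sort (· ≤ ·) = l
  induction l using List.reverseRecOn with
  | nil => exact implements_id
  | append_singleton l i ih =>
    rw [skipList_concat, List.foldl_append]
    exact (hS.implements_shift i).comp (skip_injective i) ih (strictMono_skipList l).injective

theorem exists_labelShift_eq (A : Finset ℕ) :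
    ∃ g : SInf, (Finset.range A.card).map (g : Equiv.Perm ℕ).toEmbedding = A ∧
      ∀ x ∈ S.tower A.card, S.labelShift A x = π g x := by
  obtain ⟨g, hg⟩ := SInf.exists_eqOn (Finset.range A.card) _
    (strictMono_skipList ((Finset.range (A.sup (· + 1)) \ A).sort (· ≤ ·))).injective.injOn
  refine ⟨g, ?_, fun x hx => ?_⟩
  · conv_rhs => rw [← image_skipList_range A]
    rw [Finset.map_eq_image]
    exact Finset.image_congr hg
  · exact hS.implements_labelShift A _ x (hS.tower_eq A.card ▸ hx) g
      fun j hj => hg j (Finset.mem_range.2 hj)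

theorem rootSpace_le_tower (r : ℕ) : S.rootSpace r ≤ S.tower r := by
  rw [hS.rootSpace_eq, hS.tower_eq]
  exact pureSpace_le _

/-- On the root space α_A acts as a permutation that carries the initial segment of length `A.card`
onto `A`. -/
theorem labeled_eq (A : Finset ℕ) : S.labeled A = pureSpace π A := by
  obtain ⟨g, hg, hgS⟩ := hS.exists_labelShift_eq A
  conv_rhs => rw [← hg, ← map_pureSpace, ← hS.rootSpace_eq]
  ext x
  constructor
  · rintro ⟨y, hy, rfl⟩
    exact ⟨y, hy, (hgS y (hS.rootSpace_le_tower _ hy)).symm⟩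
  · rintro ⟨y, hy, rfl⟩
    exact ⟨y, hy, hgS y (hS.rootSpace_le_tower _ hy)⟩

theorem closure_iSup_pureSpace [CompleteSpace H] :
    (⨆ A : Finset ℕ, pureSpace π A).topologicalClosure = ⊤ := by
  rw [eq_top_iff, ← S.dense]
  refine Submodule.topologicalClosure_minimal _ (iSup_le fun n => ?_)
    (Submodule.isClosed_topologicalClosure _)
  rw [hS.tower_eq]
  refine (fixedSpace_le_closure_iSup_pureSpace _).trans (Submodule.topologicalClosure_mono ?_)
  exact iSup_le fun B => le_iSup (pureSpace π) (B : Finset ℕ)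

theorem isHilbertSum_labeled [CompleteSpace H] :
    IsHilbertSum ℂ (fun A : Finset ℕ => S.labeled A) (fun A => (S.labeled A).subtypeₗᵢ) := by
  have hc : ∀ A, CompleteSpace (S.labeled A) := fun A => by
    rw [hS.labeled_eq]
    exact (isClosed_pureSpace A).completeSpace_coe
  refine IsHilbertSum.mkInternal _ (fun A B hAB x y => ?_) ?_
  · exact inner_pureSpace_eq_zero hAB ((hS.labeled_eq A).le x.2) ((hS.labeled_eq B).le y.2)
  · simp only [hS.labeled_eq]
    exact hS.closure_iSup_pureSpace.ge

end SCH.IsCanonical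

/-! ### Invariant subspaces -/

section InvariantSubspace

variable {G H : Type*} [Group G] [NormedAddCommGroup H] [InnerProductSpace ℂ H]

theorem ContinuousLinearMap.map_mem_of_mem_closure_iSup {ι : Sort*} (T : H →L[ℂ] H)
    {F : ι → Submodule ℂ H} {N : Submodule ℂ H} (hN : IsClosed (N : Set H))
    (hF : ∀ i, ∀ x ∈ F i, T x ∈ N) {x : H} (hx : x ∈ (⨆ i, F i).topologicalClosure) : T x ∈ N :=
  Submodule.topologicalClosure_minimal (t := N.comap T.toLinearMap) _
    (iSup_le fun i y hy => hF i y hy) (hN.preimage T.continuous) hx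

theorem IsInvariantSubspace.inf {σ : G →* (H ≃ₗᵢ[ℂ] H)} {K L : Submodule ℂ H}
    (hK : IsInvariantSubspace σ K) (hL : IsInvariantSubspace σ L) :
    IsInvariantSubspace σ (K ⊓ L) :=
  fun g x hx => ⟨hK g x hx.1, hL g x hx.2⟩

theorem IsInvariantSubspace.closure {σ : G →* (H ≃ₗᵢ[ℂ] H)} {K : Submodule ℂ H}
    (hK : IsInvariantSubspace σ K) : IsInvariantSubspace σ K.topologicalClosure :=
  fun g _ hx => (show Set.MapsTo (σ g) K K from hK g).closure (σ g).continuous hx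

theorem IsInvariantSubspace.iSup {ι : Sort*} {σ : G →* (H ≃ₗᵢ[ℂ] H)} {K : ι → Submodule ℂ H}
    (hK : ∀ i, IsInvariantSubspace σ (K i)) : IsInvariantSubspace σ (⨆ i, K i) := by
  intro g
  change (⨆ i, K i) ≤ (⨆ i, K i).comap (σ g).toLinearEquiv.toLinearMap
  exact iSup_le fun i x hx => Submodule.mem_iSup_of_mem i (hK i g x hx)

theorem isInvariantSubspace_iSup_map (σ : G →* (H ≃ₗᵢ[ℂ] H)) (W : Submodule ℂ H) :
    IsInvariantSubspace σ (⨆ g : G, W.map (σ g).toLinearEquiv.toLinearMap) := by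
  intro g
  change (⨆ g : G, W.map (σ g).toLinearEquiv.toLinearMap) ≤
    (⨆ g : G, W.map (σ g).toLinearEquiv.toLinearMap).comap (σ g).toLinearEquiv.toLinearMap
  refine iSup_le fun h => ?_
  rintro _ ⟨y, hy, rfl⟩
  exact Submodule.mem_iSup_of_mem (g * h) ⟨y, hy, rep_mul_apply σ g h y⟩

theorem IsInvariantSubspace.orthogonal {σ : G →* (H ≃ₗᵢ[ℂ] H)} {K : Submodule ℂ H}
    (hK : IsInvariantSubspace σ K) : IsInvariantSubspace σ Kᗮ := by
  intro g x hx y hy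
  rw [← inv_inv g, ← inner_rep_left]
  exact hx _ (hK _ y hy)

theorem IsInvariantSubspace.starProjection_rep {σ : G →* (H ≃ₗᵢ[ℂ] H)} {K : Submodule ℂ H}
    [K.HasOrthogonalProjection] (hK : IsInvariantSubspace σ K) (g : G) (x : H) :
    K.starProjection (σ g x) = σ g (K.starProjection x) := by
  refine Submodule.eq_starProjection_of_mem_orthogonal (hK g _ (K.starProjection_apply_mem x)) ?_
  rw [← map_sub]
  exact hK.orthogonal g _ (K.sub_starProjection_mem_orthogonal x)

theorem IsInvariantSubspace.starProjection_mem_fixedSpace {π : SInf →* (H ≃ₗᵢ[ℂ] H)}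
    {K : Submodule ℂ H} [K.HasOrthogonalProjection] (hK : IsInvariantSubspace π K)
    {A : Finset ℕ} {x : H} (hx : x ∈ fixedSpace π A) : K.starProjection x ∈ fixedSpace π A :=
  fun g hg => by rw [← hK.starProjection_rep, hx g hg]

theorem IsInvariantSubspace.starProjection_mem_pureSpace {π : SInf →* (H ≃ₗᵢ[ℂ] H)}
    {K : Submodule ℂ H} [K.HasOrthogonalProjection] (hK : IsInvariantSubspace π K)
    {A : Finset ℕ} {x : H} (hx : x ∈ pureSpace π A) : K.starProjection x ∈ pureSpace π A := by
  rw [mem_pureSpace] at hx ⊢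
  refine ⟨hK.starProjection_mem_fixedSpace hx.1, fun B hB y hy => ?_⟩
  rw [← Submodule.inner_starProjection_left_eq_right]
  exact hx.2 B hB _ (hK.starProjection_mem_fixedSpace hy)

/-- The projection onto `K` preserves every pure space, so it turns approximations by sums of pure
vectors into ones with all terms in `K`. -/
theorem IsInvariantSubspace.le_closure_iSup_inf_pureSpace {π : SInf →* (H ≃ₗᵢ[ℂ] H)}
    {K : Submodule ℂ H} [K.HasOrthogonalProjection] (hK : IsInvariantSubspace π K)
    {ι : Sort*} {f : ι → Finset ℕ} (hf : K ≤ (⨆ i, pureSpace π (f i)).topologicalClosure) :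
    K ≤ (⨆ i, K ⊓ pureSpace π (f i)).topologicalClosure := by
  intro x hx
  rw [← Submodule.starProjection_eq_self_iff.2 hx]
  refine ContinuousLinearMap.map_mem_of_mem_closure_iSup _
    (Submodule.isClosed_topologicalClosure _) (fun i y hy => ?_) (hf hx)
  exact Submodule.le_topologicalClosure _ (Submodule.mem_iSup_of_mem i
    ⟨K.starProjection_apply_mem y, hK.starProjection_mem_pureSpace hy⟩)

end InvariantSubspace

/-! ### Invariant subspaces and their root spaces -/

namespace SCH.IsCanonical

variable {H : Type*} [NormedAddCommGroup H] [InnerProductSpace ℂ H]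
  {π : SInf →* (H ≃ₗᵢ[ℂ] H)} {S : SCH H} (hS : S.IsCanonical π)
include hS

theorem rep_eq_symIncl {r : ℕ} {x : H} (hx : x ∈ S.tower r) (g : young r) :
    π g x = π (symIncl r (youngProj r g)) x := by
  rw [hS.tower_eq] at hx
  exact rep_congr hx fun i hi => (symIncl_youngProj_apply g (Finset.mem_range.1 hi)).symm

theorem rep_mem_of_mem_young {r : ℕ} {W : Submodule ℂ H} (hW : W ≤ S.tower r)
    (hWinv : IsInvariantSubspace (π.comp (symIncl r)) W) {g : SInf} (hg : g ∈ young r) {x : H}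
    (hx : x ∈ W) : π g x ∈ W := by
  rw [hS.rep_eq_symIncl (hW hx) ⟨g, hg⟩]
  exact hWinv _ x hx

/-- The labels provide one permutation for each `r`-set. Any other with the same image of `{0, …,
r-1}` differs from it by a factor in `young r`, which preserves `W`. -/
theorem extend_eq {r : ℕ} {W : Submodule ℂ H} (hW : W ≤ S.tower r)
    (hWinv : IsInvariantSubspace (π.comp (symIncl r)) W) :
    S.extend r W = (⨆ g : SInf, W.map (π g).toLinearEquiv.toLinearMap).topologicalClosure := by
  unfold extend
  congr 1
  refine le_antisymm (iSup_le ?_) (iSup_le fun h => ?_)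
  · rintro ⟨A, rfl⟩
    obtain ⟨g, -, hgS⟩ := hS.exists_labelShift_eq A
    refine le_iSup_of_le g ?_
    rintro _ ⟨y, hy, rfl⟩
    exact ⟨y, hy, (hgS y (hW hy)).symm⟩
  · obtain ⟨A, hA⟩ : ∃ A, A = (Finset.range r).map (h : Equiv.Perm ℕ).toEmbedding := ⟨_, rfl⟩
    obtain rfl : A.card = r := by simp [hA]
    obtain ⟨g, hg, hgS⟩ := hS.exists_labelShift_eq A
    refine le_iSup_of_le ⟨A, rfl⟩ ?_
    rintro _ ⟨y, hy, rfl⟩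
    have hyoung : g⁻¹ * h ∈ young A.card := by
      rw [mem_young_iff]
      have h1 := map_inv_map g (Finset.range A.card)
      rw [hg] at h1
      have h2 : (Finset.range A.card).map ((g⁻¹ * h : SInf) : Equiv.Perm ℕ).toEmbedding =
          ((Finset.range A.card).map (h : Equiv.Perm ℕ).toEmbedding).map
            ((g⁻¹ : SInf) : Equiv.Perm ℕ).toEmbedding := by
        rw [Finset.map_map]
        rfl
      rw [h2, ← hA, h1]
    have hmem := hS.rep_mem_of_mem_young hW hWinv hyoung hy
    refine ⟨_, hmem, ?_⟩
    change S.labelShift A _ = π h y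
    rw [hgS _ (hW hmem), ← rep_mul_apply, mul_inv_cancel_left]

theorem rankSpace_eq (r : ℕ) : S.rankSpace r =
    (⨆ A : {A : Finset ℕ // A.card = r}, pureSpace π A).topologicalClosure := by
  unfold rankSpace extend
  congr 2
  funext ⟨A, hA⟩
  subst hA
  exact hS.labeled_eq A

theorem pureSpace_le_rankSpace (A : Finset ℕ) : pureSpace π A ≤ S.rankSpace A.card := by
  rw [hS.rankSpace_eq]
  exact (le_iSup (fun B : {B : Finset ℕ // B.card = A.card} => pureSpace π (B : Finset ℕ))
    ⟨A, rfl⟩).trans (Submodule.le_topologicalClosure _)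

theorem isClosed_rootSpace (r : ℕ) : IsClosed (S.rootSpace r : Set H) := by
  rw [hS.rootSpace_eq]
  exact isClosed_pureSpace _

theorem isInvariantSubspace_rootSpace (r : ℕ) :
    IsInvariantSubspace (π.comp (symIncl r)) (S.rootSpace r) := by
  intro s x hx
  rw [hS.rootSpace_eq] at hx ⊢
  have := rep_mem_pureSpace hx (symIncl r s)
  rwa [(mem_young_iff _).1 (symIncl_mem_young s)] at this

theorem isInvariantSubspace_extend {r : ℕ} {W : Submodule ℂ H} (hW : W ≤ S.tower r)
    (hWinv : IsInvariantSubspace (π.comp (symIncl r)) W) :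
    IsInvariantSubspace π (S.extend r W) := by
  rw [hS.extend_eq hW hWinv]
  exact (isInvariantSubspace_iSup_map π W).closure

theorem isInvariantSubspace_rankSpace (r : ℕ) : IsInvariantSubspace π (S.rankSpace r) :=
  hS.isInvariantSubspace_extend (hS.rootSpace_le_tower r) (hS.isInvariantSubspace_rootSpace r)

theorem isInvariantSubspace_inf_rootSpace (r : ℕ) {K : Submodule ℂ H}
    (hK : IsInvariantSubspace π K) :
    IsInvariantSubspace (π.comp (symIncl r)) (K ⊓ S.rootSpace r) :=
  IsInvariantSubspace.inf (fun s => hK (symIncl r s)) (hS.isInvariantSubspace_rootSpace r)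

omit hS in
theorem _root_.SCH.isClosed_extend (S : SCH H) (r : ℕ) (W : Submodule ℂ H) :
    IsClosed (S.extend r W : Set H) :=
  Submodule.isClosed_topologicalClosure _

omit hS in
theorem _root_.SCH.extend_mono (S : SCH H) (r : ℕ) {W W' : Submodule ℂ H} (h : W ≤ W') :
    S.extend r W ≤ S.extend r W' :=
  Submodule.topologicalClosure_mono (iSup_mono fun _ => Submodule.map_mono h)

theorem rootSpace_le_rankSpace (r : ℕ) : S.rootSpace r ≤ S.rankSpace r := by
  have := hS.pureSpace_le_rankSpace (Finset.range r)
  rwa [Finset.card_range, ← hS.rootSpace_eq] at this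

variable [CompleteSpace H]

theorem eq_closure_iSup_inf_rankSpace {K : Submodule ℂ H} (hKc : IsClosed (K : Set H))
    (hK : IsInvariantSubspace π K) : K = (⨆ r, K ⊓ S.rankSpace r).topologicalClosure := by
  have : CompleteSpace K := hKc.completeSpace_coe
  refine le_antisymm ?_ (Submodule.topologicalClosure_minimal _ (iSup_le fun _ => inf_le_left) hKc)
  refine (hK.le_closure_iSup_inf_pureSpace (f := fun A : Finset ℕ => A)
    (by rw [hS.closure_iSup_pureSpace]; exact le_top)).trans (Submodule.topologicalClosure_mono ?_)
  exact iSup_le fun A => le_iSup_of_le A.card (inf_le_inf_left K (hS.pureSpace_le_rankSpace A))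

/-- The fixed space of a set with fewer than `r` elements is spanned by pure spaces of rank below
`r`, hence orthogonal to `S.rankSpace r`. -/
theorem tower_inf_rankSpace (r : ℕ) : S.tower r ⊓ S.rankSpace r = S.rootSpace r := by
  refine le_antisymm ?_ (le_inf (hS.rootSpace_le_tower r) (hS.rootSpace_le_rankSpace r))
  rintro x ⟨hx, hxr⟩
  rw [hS.rootSpace_eq, mem_pureSpace]
  refine ⟨hS.tower_eq r ▸ hx, fun B hB => ?_⟩
  have hcard : B.card < r := by simpa using Finset.card_lt_card hB
  have hle : S.rankSpace r ≤ (fixedSpace π B)ᗮ := by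
    rw [hS.rankSpace_eq]
    refine Submodule.topologicalClosure_minimal _ (iSup_le ?_) (Submodule.isClosed_orthogonal _)
    rintro ⟨A, rfl⟩
    refine Submodule.IsOrtho.symm (U := fixedSpace π B) ?_
    refine (fixedSpace_le_closure_iSup_pureSpace B).trans (Submodule.topologicalClosure_minimal _
      (iSup_le ?_) (Submodule.isClosed_orthogonal _))
    rintro ⟨C, hC⟩ y hy z hz
    refine inner_pureSpace_eq_zero ?_ hz hy
    rintro rfl
    exact absurd (Finset.card_le_card hC) (not_le.2 hcard)
  exact hle hxr

/-- `K` is the closed span of its pure parts of rank `r`, and each is a translate of the part in the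
root space. -/
theorem extend_inf_rootSpace {r : ℕ} {K : Submodule ℂ H} (hKc : IsClosed (K : Set H))
    (hKr : K ≤ S.rankSpace r) (hK : IsInvariantSubspace π K) :
    S.extend r (K ⊓ S.rootSpace r) = K := by
  have : CompleteSpace K := hKc.completeSpace_coe
  rw [hS.extend_eq (inf_le_right.trans (hS.rootSpace_le_tower r))
    (hS.isInvariantSubspace_inf_rootSpace r hK)]
  refine le_antisymm (Submodule.topologicalClosure_minimal _ (iSup_le fun g => ?_) hKc) ?_
  · rintro _ ⟨y, hy, rfl⟩
    exact hK g y hy.1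
  · rw [hS.rankSpace_eq] at hKr
    refine (hK.le_closure_iSup_inf_pureSpace hKr).trans (Submodule.topologicalClosure_mono ?_)
    refine iSup_le ?_
    rintro ⟨A, rfl⟩ x ⟨hxK, hx⟩
    obtain ⟨g, hg, -⟩ := hS.exists_labelShift_eq A
    rw [← hg, ← map_pureSpace, ← hS.rootSpace_eq] at hx
    obtain ⟨y, hy, rfl⟩ := hx
    refine Submodule.mem_iSup_of_mem g ⟨y, ⟨?_, hy⟩, rfl⟩
    rw [← rep_inv_apply_self π g y]
    exact hK _ _ hxK

/-- Project the translates of `W` onto the root space: those by `young r` stay in `W`, all others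
are orthogonal to the root space and vanish. -/
theorem extend_inf_rootSpace_eq {r : ℕ} {W : Submodule ℂ H} (hWc : IsClosed (W : Set H))
    (hWr : W ≤ S.rootSpace r) (hW : IsInvariantSubspace (π.comp (symIncl r)) W) :
    S.extend r W ⊓ S.rootSpace r = W := by
  have : CompleteSpace (S.rootSpace r) := (hS.isClosed_rootSpace r).completeSpace_coe
  have hWt := hWr.trans (hS.rootSpace_le_tower r)
  rw [hS.extend_eq hWt hW]
  refine le_antisymm ?_ (le_inf ?_ hWr)
  · rintro x ⟨hx, hxr⟩
    rw [← Submodule.starProjection_eq_self_iff.2 hxr]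
    refine ContinuousLinearMap.map_mem_of_mem_closure_iSup _ hWc (fun g y hy => ?_) hx
    obtain ⟨w, hw, rfl⟩ := hy
    change (S.rootSpace r).starProjection (π g w) ∈ W
    by_cases hg : g ∈ young r
    · have := hS.rep_mem_of_mem_young hWt hW hg hw
      rwa [Submodule.starProjection_eq_self_iff.2 (hWr this)]
    · convert W.zero_mem
      rw [Submodule.starProjection_apply_eq_zero_iff]
      intro z hz
      have hw' := hWr hw
      rw [hS.rootSpace_eq] at hz hw'
      exact inner_pureSpace_eq_zero (fun h => hg ((mem_young_iff g).2 h.symm)) hz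
        (rep_mem_pureSpace hw' g)
  · refine le_trans ?_ (Submodule.le_topologicalClosure _)
    refine le_iSup_of_le 1 fun x hx => ⟨x, hx, ?_⟩
    rw [map_one]
    rfl

theorem invOn_extend (r : ℕ) : Set.InvOn (S.extend r) (fun K => K ⊓ S.rootSpace r)
    {K | IsClosed (K : Set H) ∧ K ≤ S.rankSpace r ∧ IsInvariantSubspace π K}
    {W | IsClosed (W : Set H) ∧ W ≤ S.rootSpace r ∧
      IsInvariantSubspace (π.comp (symIncl r)) W} :=
  ⟨fun _ hK => hS.extend_inf_rootSpace hK.1 hK.2.1 hK.2.2,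
    fun _ hW => hS.extend_inf_rootSpace_eq hW.1 hW.2.1 hW.2.2⟩

theorem bijOn_inf_rootSpace (r : ℕ) : Set.BijOn (fun K => K ⊓ S.rootSpace r)
    {K | IsClosed (K : Set H) ∧ K ≤ S.rankSpace r ∧ IsInvariantSubspace π K}
    {W | IsClosed (W : Set H) ∧ W ≤ S.rootSpace r ∧
      IsInvariantSubspace (π.comp (symIncl r)) W} :=
  (hS.invOn_extend r).bijOn
    (fun _ hK => ⟨hK.1.inter (hS.isClosed_rootSpace r), inf_le_right,
      hS.isInvariantSubspace_inf_rootSpace r hK.2.2⟩)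
    (fun _ hW => ⟨S.isClosed_extend r _, S.extend_mono r hW.2.1,
      hS.isInvariantSubspace_extend (hW.2.1.trans (hS.rootSpace_le_tower r)) hW.2.2⟩)

end SCH.IsCanonical

/-! ### Induced representations inside a given representation -/

section Imprimitivity

variable {G V W : Type*} [Group G] [NormedAddCommGroup V] [InnerProductSpace ℂ V]
  [NormedAddCommGroup W] [InnerProductSpace ℂ W]
  {K : Subgroup G} {ρ : K →* (W ≃ₗᵢ[ℂ] W)} {σ : G →* (V ≃ₗᵢ[ℂ] V)} {ι : W →ₗᵢ[ℂ] V}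

/-- Changing the representative of a coset changes the embedding of `W` only by an operator `ρ k`,
so one copy per coset suffices. -/
theorem isHilbertSum_quotient [CompleteSpace V] [CompleteSpace W]
    (hι : ∀ (k : K) (w : W), ι (ρ k w) = σ k (ι w))
    (horth : ∀ g ∉ K, ∀ w w' : W, inner ℂ (ι w) (σ g (ι w')) = 0)
    (htot : ∀ x : V, (∀ (g : G) (w : W), inner ℂ (σ g (ι w)) x = 0) → x = 0) :
    IsHilbertSum ℂ (fun _ : G ⧸ K => W)
      (fun q : G ⧸ K => (σ q.out).toLinearIsometry.comp ι) := by
  refine IsHilbertSum.mk (fun p q hpq w w' => ?_) ?_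
  · change inner ℂ (σ p.out (ι w)) (σ q.out (ι w')) = 0
    rw [inner_rep_left, ← rep_mul_apply]
    refine horth _ (fun h => hpq ?_) w w'
    rw [← QuotientGroup.out_eq' p, ← QuotientGroup.out_eq' q]
    exact QuotientGroup.eq.2 h
  · rw [top_le_iff, Submodule.topologicalClosure_eq_top_iff, Submodule.eq_bot_iff]
    intro x hx
    refine htot x fun g w => ?_
    obtain ⟨k, hk⟩ := QuotientGroup.mk_out_eq_mul K g
    have hg : σ g (ι w) = σ (g : G ⧸ K).out (ι (ρ k⁻¹ w)) := by
      rw [hι, ← rep_mul_apply, hk]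
      simp
    rw [hg]
    exact hx _ (Submodule.mem_iSup_of_mem (g : G ⧸ K) ⟨_, rfl⟩)

/-- A representation of `G` generated by a subspace that is invariant under the subgroup `K`, and
whose translates under different cosets of `K` are orthogonal, is induced from `K`. -/
theorem unitarilyEquivalent_inducedRep [CompleteSpace V] [CompleteSpace W]
    (hι : ∀ (k : K) (w : W), ι (ρ k w) = σ k (ι w))
    (horth : ∀ g ∉ K, ∀ w w' : W, inner ℂ (ι w) (σ g (ι w')) = 0)
    (htot : ∀ x : V, (∀ (g : G) (w : W), inner ℂ (σ g (ι w)) x = 0) → x = 0) :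
    UnitarilyEquivalent σ (inducedRep ρ) := by
  classical
  have hsum := isHilbertSum_quotient hι horth htot
  let Φ := hsum.linearIsometryEquiv
  -- The intertwiner sends `x` to the function `g ↦ T (σ g⁻¹ x)`; at a representative this is the
  -- coordinate of `x` in the Hilbert sum.
  let T : V →L[ℂ] W := ContinuousLinearMap.adjoint ι.toContinuousLinearMap
  have hT : ∀ (w : W) (x : V), inner ℂ w (T x) = inner ℂ (ι w) x := fun w x =>
    ContinuousLinearMap.adjoint_inner_right ι.toContinuousLinearMap w x
  have hcoord : ∀ (x : V) (q : G ⧸ K), T (σ q.out⁻¹ x) = Φ x q := by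
    intro x q
    refine ext_inner_left ℂ fun w => ?_
    refine Eq.trans ?_ (lp.inner_single_left (𝕜 := ℂ) (G := fun _ : G ⧸ K => W) q w (Φ x))
    rw [hT, ← inner_rep_left, ← Φ.symm.inner_map_map, Φ.symm_apply_apply,
      hsum.linearIsometryEquiv_symm_apply_single]
    rfl
  have hcov : ∀ x : V, IsCovariant ρ fun g => T (σ g⁻¹ x) := by
    intro x g k
    refine ext_inner_left ℂ fun w => ?_
    rw [← map_inv, ← inner_rep_left ρ, hT, hT, hι, mul_inv_rev, rep_mul_apply, inner_rep_left σ]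
  let U : V →ₗᵢ[ℂ] InducedSpace ρ :=
    { toFun := fun x => ⟨fun g => T (σ g⁻¹ x), hcov x, by
        simp only [hcoord]
        exact (memlp_iff_summable_sq _).1 (Φ x).2⟩
      map_add' := fun x y => InducedSpace.ext fun g => by
        change T (σ g⁻¹ (x + y)) = T (σ g⁻¹ x) + T (σ g⁻¹ y)
        rw [map_add, map_add]
      map_smul' := fun c x => InducedSpace.ext fun g => by
        change T (σ g⁻¹ (c • x)) = c • T (σ g⁻¹ x)
        rw [map_smul, map_smul]
      norm_map' := fun x => by
        rw [@norm_eq_sqrt_re_inner ℂ, @norm_eq_sqrt_re_inner ℂ, InducedSpace.inner_toLp,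
          ← Φ.inner_map_map]
        congr 3 <;> exact lp.ext (funext fun q => hcoord x q) }
  have hU : ∀ x, InducedSpace.toLp ρ (U x) = Φ x := fun x => lp.ext (funext fun q => hcoord x q)
  refine ⟨LinearIsometryEquiv.ofSurjective U fun f => ⟨Φ.symm (InducedSpace.toLp ρ f),
    InducedSpace.toLp_injective ρ ?_⟩, fun a x => InducedSpace.ext fun g => ?_⟩
  · rw [hU, Φ.apply_symm_apply]
  · change T (σ g⁻¹ (σ a x)) = T (σ (a⁻¹ * g)⁻¹ x)
    rw [← rep_mul_apply, mul_inv_rev, inv_inv]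

end Imprimitivity

namespace SCH.IsCanonical

variable {H : Type*} [NormedAddCommGroup H] [InnerProductSpace ℂ H] [CompleteSpace H]
  {π : SInf →* (H ≃ₗᵢ[ℂ] H)} {S : SCH H} (hS : S.IsCanonical π)
include hS

theorem unitarilyEquivalent_inducedFromFinite {r : ℕ} {K : Submodule ℂ H}
    (hK : IsInvariantSubspace π K) (hKc : IsClosed (K : Set H)) (hKr : K ≤ S.rankSpace r)
    (hW : IsInvariantSubspace (π.comp (symIncl r)) (K ⊓ S.rootSpace r)) :
    UnitarilyEquivalent (subrep π K hK)
      (inducedFromFinite r (subrep (π.comp (symIncl r)) (K ⊓ S.rootSpace r) hW)) := by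
  have : CompleteSpace K := hKc.completeSpace_coe
  have : CompleteSpace ↥(K ⊓ S.rootSpace r) :=
    (hKc.inter (hS.isClosed_rootSpace r)).completeSpace_coe
  let ι : ↥(K ⊓ S.rootSpace r) →ₗᵢ[ℂ] K :=
    { Submodule.inclusion (inf_le_left (a := K) (b := S.rootSpace r)) with
      norm_map' := fun _ => rfl }
  refine unitarilyEquivalent_inducedRep (ι := ι) (fun k w => Subtype.ext ?_)
    (fun g hg w w' => ?_) (fun x hx => ?_)
  · exact (hS.rep_eq_symIncl (hS.rootSpace_le_tower r w.2.2) k).symm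
  · change inner ℂ (w : H) (π g (w' : H)) = 0
    have hr := (hS.rootSpace_eq r).le
    exact inner_pureSpace_eq_zero (fun h => hg ((mem_young_iff g).2 h.symm)) (hr w.2.2)
      (rep_mem_pureSpace (hr w'.2.2) g)
  -- `K` is the closed span of the translates of its root space, so `x` is orthogonal to `K` and to
  -- itself.
  · have h1 : K ≤ (ℂ ∙ (x : H))ᗮ := by
      refine (hS.extend_inf_rootSpace hKc hKr hK).ge.trans ?_
      rw [hS.extend_eq (inf_le_right.trans (hS.rootSpace_le_tower r)) hW]
      refine Submodule.topologicalClosure_minimal _ (iSup_le fun g => ?_)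
        (Submodule.isClosed_orthogonal _)
      rintro _ ⟨y, hy, rfl⟩
      rw [Submodule.mem_orthogonal_singleton_iff_inner_left]
      exact hx g ⟨y, hy⟩
    have h2 := Submodule.mem_orthogonal_singleton_iff_inner_left.1 (h1 x.2)
    exact Subtype.ext (inner_self_eq_zero.1 h2)

end SCH.IsCanonical

/-! ### Irreducible subspaces -/

section Irreducible

variable {G H : Type*} [Group G] [NormedAddCommGroup H] [InnerProductSpace ℂ H]
  {σ : G →* (H ≃ₗᵢ[ℂ] H)}

theorem isIrreducibleRep_subrep_iff {V : Submodule ℂ H} (hVc : IsClosed (V : Set H))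
    (hV : IsInvariantSubspace σ V) :
    IsIrreducibleRep (subrep σ V hV) ↔ V ≠ ⊥ ∧ ∀ K : Submodule ℂ H, IsClosed (K : Set H) →
      IsInvariantSubspace σ K → K ≤ V → K = ⊥ ∨ K = V := by
  unfold IsIrreducibleRep
  rw [Submodule.nontrivial_iff_ne_bot]
  refine and_congr_right fun _ => ⟨fun h K hKc hK hKV => ?_, fun h K hKc hK => ?_⟩
  · have h1 : (K.comap V.subtype).map V.subtype = K := by
      rw [Submodule.map_comap_subtype, inf_eq_right.2 hKV]
    rcases h (K.comap V.subtype) (hKc.preimage continuous_subtype_val)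
      (fun g x hx => hK g x hx) with h2 | h2
    · exact Or.inl (by rw [← h1, h2, Submodule.map_bot])
    · exact Or.inr (by rw [← h1, h2, Submodule.map_subtype_top])
  · have hmap := Submodule.map_injective_of_injective V.injective_subtype
    rcases h (K.map V.subtype) (hVc.isClosedEmbedding_subtypeVal.isClosedMap _ hKc) (by
      rintro g _ ⟨x, hx, rfl⟩
      exact ⟨_, hK g x hx, rfl⟩) (Submodule.map_subtype_le _ _) with h2 | h2
    · exact Or.inl (hmap (by rw [h2, Submodule.map_bot]))
    · exact Or.inr (hmap (by rw [h2, Submodule.map_subtype_top]))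

theorem exists_finiteDimensional_invariant [Finite G] {W : Submodule ℂ H}
    (hW : IsInvariantSubspace σ W) (hne : W ≠ ⊥) :
    ∃ W₀ ≤ W, W₀ ≠ ⊥ ∧ FiniteDimensional ℂ W₀ ∧ IsInvariantSubspace σ W₀ := by
  obtain ⟨w, hw, hw0⟩ := Submodule.exists_mem_ne_zero_of_ne_bot hne
  refine ⟨Submodule.span ℂ (Set.range fun g => σ g w), ?_, ?_, ?_, ?_⟩
  · rw [Submodule.span_le]
    rintro _ ⟨g, rfl⟩
    exact hW g w hw
  · refine (Submodule.ne_bot_iff _).2 ⟨w, Submodule.subset_span ⟨1, ?_⟩, hw0⟩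
    simp
  · exact FiniteDimensional.span_of_finite ℂ (Set.finite_range _)
  · intro g
    change _ ≤ (Submodule.span ℂ (Set.range fun g => σ g w)).comap (σ g).toLinearEquiv.toLinearMap
    rw [Submodule.span_le]
    rintro _ ⟨h, rfl⟩
    exact Submodule.subset_span ⟨g * h, rep_mul_apply σ g h w⟩

/-- The span of a finite orbit is finite-dimensional; take a nonzero invariant subspace of least
dimension. -/
theorem exists_irreducible_invariant [Finite G] {W : Submodule ℂ H}
    (hW : IsInvariantSubspace σ W) (hne : W ≠ ⊥) :
    ∃ W₀ ≤ W, W₀ ≠ ⊥ ∧ IsClosed (W₀ : Set H) ∧ IsInvariantSubspace σ W₀ ∧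
      ∀ K : Submodule ℂ H, IsInvariantSubspace σ K → K ≤ W₀ → K = ⊥ ∨ K = W₀ := by
  obtain ⟨W₀, ⟨h1, h2, h3, h4⟩, hmin⟩ :=
    (measure fun W₀ : Submodule ℂ H => Module.finrank ℂ W₀).wf.has_min
      {W₀ | W₀ ≤ W ∧ W₀ ≠ ⊥ ∧ FiniteDimensional ℂ W₀ ∧ IsInvariantSubspace σ W₀}
      (exists_finiteDimensional_invariant hW hne)
  refine ⟨W₀, h1, h2, W₀.closed_of_finiteDimensional, h4, fun K hK hKW => ?_⟩
  by_contra! h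
  have := Submodule.finiteDimensional_of_le hKW
  exact hmin K ⟨hKW.trans h1, h.1, this, hK⟩
    (Submodule.finrank_lt_finrank_of_lt (lt_of_le_of_ne hKW h.2))

end Irreducible

/-! ### Decomposition and structure of irreducibles -/

namespace SCH.IsCanonical

variable {H : Type*} [NormedAddCommGroup H] [InnerProductSpace ℂ H] [CompleteSpace H]
  {π : SInf →* (H ≃ₗᵢ[ℂ] H)} {S : SCH H} (hS : S.IsCanonical π)
include hS

theorem exists_inf_rankSpace_ne_bot {K : Submodule ℂ H} (hKc : IsClosed (K : Set H))
    (hK : IsInvariantSubspace π K) (hne : K ≠ ⊥) : ∃ r, K ⊓ S.rankSpace r ≠ ⊥ := by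
  by_contra! h
  refine hne ?_
  rw [hS.eq_closure_iSup_inf_rankSpace hKc hK]
  simp only [h, iSup_bot]
  exact isClosed_singleton.submodule_topologicalClosure_eq

omit hS [CompleteSpace H] in
theorem _root_.SCH.extend_bot (S : SCH H) (r : ℕ) : S.extend r ⊥ = ⊥ := by
  unfold SCH.extend
  simp only [Submodule.map_bot, iSup_bot]
  exact isClosed_singleton.submodule_topologicalClosure_eq

theorem inf_rootSpace_ne_bot {r : ℕ} {K : Submodule ℂ H} (hKc : IsClosed (K : Set H))
    (hKr : K ≤ S.rankSpace r) (hK : IsInvariantSubspace π K) (hne : K ≠ ⊥) :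
    K ⊓ S.rootSpace r ≠ ⊥ := fun h => hne (by
  rw [← hS.extend_inf_rootSpace hKc hKr hK, h, S.extend_bot])

/-- Some rank component of `K` is nonzero. Its root space contains an irreducible `W`, and the
correspondence makes `S.extend r W` irreducible. -/
theorem exists_irreducible_le {K : Submodule ℂ H} (hKc : IsClosed (K : Set H))
    (hK : IsInvariantSubspace π K) (hne : K ≠ ⊥) :
    ∃ V ≤ K, V ≠ ⊥ ∧ IsClosed (V : Set H) ∧
      ∃ hV : IsInvariantSubspace π V, IsIrreducibleRep (subrep π V hV) := by
  obtain ⟨r, hr⟩ := hS.exists_inf_rankSpace_ne_bot hKc hK hne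
  have hLc : IsClosed ((K ⊓ S.rankSpace r : Submodule ℂ H) : Set H) :=
    hKc.inter (S.isClosed_extend r _)
  have hL := hK.inf (hS.isInvariantSubspace_rankSpace r)
  obtain ⟨W, hWL, hW0, hWc, hW, hirr⟩ := exists_irreducible_invariant
    (hS.isInvariantSubspace_inf_rootSpace r hL) (hS.inf_rootSpace_ne_bot hLc inf_le_right hL hr)
  have hWr : W ≤ S.rootSpace r := hWL.trans inf_le_right
  have hWE := hS.extend_inf_rootSpace_eq hWc hWr hW
  have hE : IsInvariantSubspace π (S.extend r W) :=
    hS.isInvariantSubspace_extend (hWr.trans (hS.rootSpace_le_tower r)) hW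
  have hE0 : S.extend r W ≠ ⊥ := fun h => hW0 (by rw [← hWE, h, bot_inf_eq])
  refine ⟨S.extend r W, ?_, hE0, S.isClosed_extend r W, hE,
    (isIrreducibleRep_subrep_iff (S.isClosed_extend r W) hE).2 ⟨hE0, fun L hLc' hL' hLE => ?_⟩⟩
  · refine le_trans ?_ (inf_le_left (b := S.rankSpace r))
    rw [← hS.extend_inf_rootSpace hLc inf_le_right hL]
    exact S.extend_mono r hWL
  · have hLr : L ≤ S.rankSpace r := hLE.trans (S.extend_mono r hWr)
    rcases hirr (L ⊓ S.rootSpace r) (hS.isInvariantSubspace_inf_rootSpace r hL')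
      ((inf_le_inf_right _ hLE).trans hWE.le) with h | h
    · left
      rw [← hS.extend_inf_rootSpace hLc' hLr hL', h, S.extend_bot]
    · right
      rw [← hS.extend_inf_rootSpace hLc' hLr hL', h]

theorem exists_isHilbertSum_irreducible : ∃ 𝒱 : Set (Submodule ℂ H),
    (∀ V ∈ 𝒱, IsClosed (V : Set H) ∧
      ∃ hV : IsInvariantSubspace π V, IsIrreducibleRep (subrep π V hV)) ∧
    IsHilbertSum ℂ (fun V : 𝒱 => (V : Submodule ℂ H))
      (fun V : 𝒱 => (V : Submodule ℂ H).subtypeₗᵢ) := by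
  obtain ⟨𝒱, hmax⟩ := zorn_subset {𝒱 : Set (Submodule ℂ H) |
      (∀ V ∈ 𝒱, IsClosed (V : Set H) ∧
        ∃ hV : IsInvariantSubspace π V, IsIrreducibleRep (subrep π V hV)) ∧
      𝒱.Pairwise Submodule.IsOrtho} (by
    intro c hc hchain
    refine ⟨⋃₀ c, ⟨?_, ?_⟩, fun s hs => Set.subset_sUnion_of_mem hs⟩
    · rintro V ⟨s, hs, hV⟩
      exact (hc hs).1 V hV
    · exact (Set.pairwise_sUnion hchain.directedOn).2 fun s hs => (hc hs).2)
  obtain ⟨h𝒱, hpair⟩ := hmax.prop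
  refine ⟨𝒱, h𝒱, ?_⟩
  have hc : ∀ V : 𝒱, CompleteSpace (V : Submodule ℂ H) := fun V =>
    (h𝒱 V V.2).1.completeSpace_coe
  refine IsHilbertSum.mkInternal _ (fun V V' hVV x y => ?_) ?_
  · exact Submodule.isOrtho_iff_inner_eq.1
      (hpair V.2 V'.2 fun h => hVV (Subtype.ext h)) x x.2 y y.2
  · rw [top_le_iff, Submodule.topologicalClosure_eq_top_iff]
    by_contra hne
    have hinv : IsInvariantSubspace π (⨆ V : 𝒱, (V : Submodule ℂ H))ᗮ :=
      (IsInvariantSubspace.iSup fun V : 𝒱 => (h𝒱 V V.2).2.1).orthogonal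
    -- An irreducible subspace of the orthogonal complement belongs to the maximal family, hence is
    -- orthogonal to itself.
    obtain ⟨V, hVK, hV0, hVc, hV⟩ :=
      hS.exists_irreducible_le (Submodule.isClosed_orthogonal _) hinv hne
    have horth : ∀ V' ∈ 𝒱, V ⟂ V' := fun V' hV' =>
      hVK.trans (Submodule.orthogonal_le (le_iSup (fun V : 𝒱 => (V : Submodule ℂ H)) ⟨V', hV'⟩))
    have hmem : V ∈ 𝒱 := by
      refine hmax.le_of_ge (y := insert V 𝒱) ⟨?_, ?_⟩ (Set.subset_insert _ _)
        (Set.mem_insert _ _)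
      · rintro V' (rfl | hV')
        · exact ⟨hVc, hV⟩
        · exact h𝒱 V' hV'
      · exact hpair.insert fun V' hV' _ => ⟨horth V' hV', (horth V' hV').symm⟩
    exact hV0 (Submodule.isOrtho_self.1 (horth V hmem))

/-- A nonzero rank component of `V` is all of `V`. The correspondence transfers irreducibility to
the root space, which then equals the span of one finite orbit. -/
theorem irreducible_structure {V : Submodule ℂ H} (hV : IsInvariantSubspace π V)
    (hVc : IsClosed (V : Set H)) (hirr : IsIrreducibleRep (subrep π V hV)) :
    ∃ (r : ℕ) (hW : IsInvariantSubspace (π.comp (symIncl r)) (V ⊓ S.rootSpace r)),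
      V ≤ S.rankSpace r ∧
      FiniteDimensional ℂ ↥(V ⊓ S.rootSpace r) ∧
      IsIrreducibleRep (subrep (π.comp (symIncl r)) (V ⊓ S.rootSpace r) hW) := by
  obtain ⟨hV0, hirr⟩ := (isIrreducibleRep_subrep_iff hVc hV).1 hirr
  obtain ⟨r, hr⟩ := hS.exists_inf_rankSpace_ne_bot hVc hV hV0
  have hVr : V ≤ S.rankSpace r := inf_eq_left.1 <|
    (hirr _ (hVc.inter (S.isClosed_extend r _)) (hV.inf (hS.isInvariantSubspace_rankSpace r))
      inf_le_left).resolve_left hr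
  have hW := hS.isInvariantSubspace_inf_rootSpace r hV
  have hWc : IsClosed ((V ⊓ S.rootSpace r : Submodule ℂ H) : Set H) :=
    hVc.inter (hS.isClosed_rootSpace r)
  have hW0 := hS.inf_rootSpace_ne_bot hVc hVr hV hV0
  have hWirr : ∀ K : Submodule ℂ H, IsClosed (K : Set H) →
      IsInvariantSubspace (π.comp (symIncl r)) K → K ≤ V ⊓ S.rootSpace r →
      K = ⊥ ∨ K = V ⊓ S.rootSpace r := by
    intro K hKc hK hKW
    have hKr := hKW.trans inf_le_right
    have hKE := hS.extend_inf_rootSpace_eq hKc hKr hK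
    have hKV : S.extend r K ≤ V := by
      rw [← hS.extend_inf_rootSpace hVc hVr hV]
      exact S.extend_mono r hKW
    rcases hirr _ (S.isClosed_extend r K)
      (hS.isInvariantSubspace_extend (hKr.trans (hS.rootSpace_le_tower r)) hK) hKV with h | h
    · left
      rw [← hKE, h, bot_inf_eq]
    · right
      rw [← hKE, h]
  refine ⟨r, hW, hVr, ?_, (isIrreducibleRep_subrep_iff hWc hW).2 ⟨hW0, hWirr⟩⟩
  obtain ⟨W₀, hle, hne, hfin, hinv⟩ := exists_finiteDimensional_invariant hW hW0
  rw [← (hWirr W₀ W₀.closed_of_finiteDimensional hinv hle).resolve_left hne]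
  exact hfin

end SCH.IsCanonical

theorem mainTheorem4 {H : Type*} [NormedAddCommGroup H] [InnerProductSpace ℂ H] [CompleteSpace H]
    (π : SInf →* (H ≃ₗᵢ[ℂ] H)) (hπ : IsTame π) :
    -- the canonical SCH exists and is normal
    ∃ S : SCH H, S.IsCanonical π ∧ S.IsNormal ∧
      -- `H` is the orthogonal sum of the labeled subspaces, which are permuted by `π`
      (IsHilbertSum ℂ (fun A : Finset ℕ => S.labeled A) (fun A => (S.labeled A).subtypeₗᵢ) ∧
        ∀ (g : SInf) (A : Finset ℕ), (S.labeled A).map (π g).toLinearEquiv.toLinearMap =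
          S.labeled (A.map (g : Equiv.Perm ℕ).toEmbedding)) ∧
      -- every closed invariant subspace is decomposed by rank
      ((∀ r, IsInvariantSubspace π (S.rankSpace r)) ∧
        ∀ K : Submodule ℂ H, IsClosed (K : Set H) → IsInvariantSubspace π K →
          K = (⨆ r, K ⊓ S.rankSpace r).topologicalClosure) ∧
      -- in rank `r`: invariant subspaces correspond to `S_r`-invariant subspaces of the root space
      (∀ r, S.tower r ⊓ S.rankSpace r = S.rootSpace r ∧
        Set.BijOn (fun K => K ⊓ S.rootSpace r)
          {K | IsClosed (K : Set H) ∧ K ≤ S.rankSpace r ∧ IsInvariantSubspace π K}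
          {W | IsClosed (W : Set H) ∧ W ≤ S.rootSpace r ∧ IsInvariantSubspace (π.comp (symIncl r)) W} ∧
        Set.InvOn (S.extend r) (fun K => K ⊓ S.rootSpace r)
          {K | IsClosed (K : Set H) ∧ K ≤ S.rankSpace r ∧ IsInvariantSubspace π K}
          {W | IsClosed (W : Set H) ∧ W ≤ S.rootSpace r ∧ IsInvariantSubspace (π.comp (symIncl r)) W}) ∧
      -- in rank `r`: an invariant subspace carries the representation induced from its root space
      (∀ (r : ℕ) (K : Submodule ℂ H) (hK : IsInvariantSubspace π K), IsClosed (K : Set H) →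
        K ≤ S.rankSpace r →
        ∃ hW : IsInvariantSubspace (π.comp (symIncl r)) (K ⊓ S.rootSpace r),
          UnitarilyEquivalent (subrep π K hK)
            (inducedFromFinite r (subrep (π.comp (symIncl r)) (K ⊓ S.rootSpace r) hW))) ∧
      -- decomposition into irreducibles
      (∃ 𝒱 : Set (Submodule ℂ H),
        (∀ V ∈ 𝒱, IsClosed (V : Set H) ∧
          ∃ hV : IsInvariantSubspace π V, IsIrreducibleRep (subrep π V hV)) ∧
        IsHilbertSum ℂ (fun V : 𝒱 => (V : Submodule ℂ H))
          (fun V : 𝒱 => (V : Submodule ℂ H).subtypeₗᵢ)) ∧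
      -- irreducibles are induced from irreducibles of finite symmetric groups
      (∀ (V : Submodule ℂ H) (hV : IsInvariantSubspace π V), IsClosed (V : Set H) →
        IsIrreducibleRep (subrep π V hV) →
        ∃ (r : ℕ) (hW : IsInvariantSubspace (π.comp (symIncl r)) (V ⊓ S.rootSpace r)),
          V ≤ S.rankSpace r ∧
          FiniteDimensional ℂ ↥(V ⊓ S.rootSpace r) ∧
          IsIrreducibleRep (subrep (π.comp (symIncl r)) (V ⊓ S.rootSpace r) hW) ∧
          UnitarilyEquivalent (subrep π V hV)
            (inducedFromFinite r (subrep (π.comp (symIncl r)) (V ⊓ S.rootSpace r) hW))) := by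
  have hS := isCanonical_canonicalSCH hπ
  refine ⟨canonicalSCH hπ, hS, hS.isNormal, ⟨hS.isHilbertSum_labeled, fun g A => ?_⟩,
    ⟨hS.isInvariantSubspace_rankSpace, fun K => hS.eq_closure_iSup_inf_rankSpace⟩,
    fun r => ⟨hS.tower_inf_rankSpace r, hS.bijOn_inf_rootSpace r, hS.invOn_extend r⟩,
    fun r K hK hKc hKr => ⟨hS.isInvariantSubspace_inf_rootSpace r hK,
      hS.unitarilyEquivalent_inducedFromFinite hK hKc hKr _⟩,
    hS.exists_isHilbertSum_irreducible, fun V hV hVc hirr => ?_⟩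
  · rw [hS.labeled_eq, hS.labeled_eq, map_pureSpace]
  · obtain ⟨r, hW, hVr, hfin, hWirr⟩ := hS.irreducible_structure hV hVc hirr
    exact ⟨r, hW, hVr, hfin, hWirr, hS.unitarilyEquivalent_inducedFromFinite hV hVc hVr hW⟩
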